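/- Let $\beta\in\{2,4\}$, $m\ge 1$ an integer, and $\mathcal T>0$. For $0\le \nu\le q$, $0\le n\le p$ let $$G^{\nu,n}_{p,q}\Big({a_1,\dots,a_p\atop b_1,\dots,b_q}\Big|\,x\Big)=\frac1{2\pi i}\int_L x^s\,\frac{\prod_{j=1}^{\nu}\Gamma(b_j-s)\prod_{j=1}^{n}\Gamma(1-a_j+s)}{\prod_{j=\nu+1}^{q}\Gamma(1-b_j+s)\prod_{j=n+1}^{p}\Gamma(a_j-s)}\,ds$$ be the Meijer $G$-function, where $L$ is an upward vertical line with the poles of $\Gamma(b_j-s)$, $j\le \nu$, to its right and those of $\Gamma(1-a_j+s)$, $j\le n$, to its left. Let $\boldsymbol{k}=(k,\dots,k)$ denote a vector of length $m$. For $N\ge1$ set $$Q_N(z)=-\frac1N\log G^{m,0}_{0,m}\Big({-\atop \boldsymbol{0}}\Big|\Big(\frac{\beta N}{2}\Big)^m|z|^2\Big),$$ the potential of the product of $m$ complex ($\beta=2$) or quaternionic ($\beta=4$) Ginibre matrices of size $N$. Let $z_1,\dots,z_N\in\mathbb C$ have the joint density, with respect to $\prod_j dA(z_j)$, $dA=\pi^{-1}d^2z$,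 given by $$\frac1{Z_N}\prod_{j>k}|z_j-z_k|^2\prod_{j}e^{-NQ_N(z_j)}\quad(\beta=2),\qquad \frac1{Z_N}\prod_{j>k}|z_j-z_k|^2|z_j-\bar z_k|^2\prod_j|z_j-\bar z_j|^2e^{-NQ_N(z_j)}\quad(\beta=4),$$ where $Z_N$ is the normalising constant. Let $E_N^{(\beta)}(a)$ and $V_N^{(\beta)}(a)$ be the mean and the variance of the number of indices $j$ with $|z_j|<a$. Then these densities define probability measures for all $N\ge 1$, and, with convergent series, $$\lim_{N\to\infty}E_N^{(\beta)}\Big(\frac{\mathcal T}{N^{m/2}}\Big)=\sum_{j=1}^\infty\frac1{(\frac\beta2 j-1)!^{m}}\,G^{m,1}_{1,m+1}\Big({1\atop \boldsymbol{\tfrac\beta2 j},0}\Big|\Big(\frac\beta2\Big)^m\mathcal T^2\Big),$$ $$\lim_{N\to\infty}V_N^{(\beta)}\Big(\frac{\mathcal T}{N^{m/2}}\Big)=\sum_{j=1}^\infty\frac1{(\frac\beta2 j-1)!^{2m}}\,G^{m,1}_{1,m+1}\Big({1\atop \boldsymbol{\tfrac\beta2 j},0}\Big|\Big(\frac\beta2\Big)^m\mathcal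 T^2\Big)\,G^{m+1,0}_{1,m+1}\Big({1\atop 0,\boldsymbol{\tfrac\beta2 j}}\Big|\Big(\frac\beta2\Big)^m\mathcal T^2\Big).$$ -/

import Mathlib

open MeasureTheory ProbabilityTheory Filter Topology

noncomputable section

namespace PlanarEnsemble

/-! ### The Meijer G-function -/

/-- The Mellin-Barnes integrand of `G^{m,n}_{p,q}(a; b | z)`:
`z^s ∏_{j ≤ m} Γ(b_j - s) ∏_{j ≤ n} Γ(1 - a_j + s)`
divided by `∏_{m < j ≤ q} Γ(1 - b_j + s) ∏_{n < j ≤ p} Γ(a_j - s)`.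
(The first index of the vectors is `0` here, so `j ≤ m` reads `j < m`. The function `(Γ w)⁻¹` of
Mathlib is the entire function `1 / Γ`, zero at the poles of `Γ`.) -/
def meijerIntegrand (m n : ℕ) {p q : ℕ} (a : Fin p → ℂ) (b : Fin q → ℂ) (z s : ℂ) : ℂ :=
  z ^ s
    * (∏ j : Fin q,
        if (j : ℕ) < m then Complex.Gamma (b j - s) else (Complex.Gamma (1 - b j + s))⁻¹)
    * (∏ j : Fin p,
        if (j : ℕ) < n then Complex.Gamma (1 - a j + s) else (Complex.Gamma (a j - s))⁻¹)

/-- The vertical line `Re s = c` has all the poles `b_j + ℓ` (`j ≤ m`, `ℓ ≥ 0`) of the functions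
`Γ(b_j - s)` to its right and all the poles `a_j - 1 - ℓ` (`j ≤ n`, `ℓ ≥ 0`) of the functions
`Γ(1 - a_j + s)` to its left. -/
def Separates (m n : ℕ) {p q : ℕ} (a : Fin p → ℂ) (b : Fin q → ℂ) (c : ℝ) : Prop :=
  (∀ j : Fin q, (j : ℕ) < m → c < (b j).re) ∧ (∀ j : Fin p, (j : ℕ) < n → (a j).re - 1 < c)

open Classical in
/-- The Meijer G-function `G^{m,n}_{p,q}(a; b | z) = (2πi)⁻¹ ∫_L (integrand) ds`, the contour `L`
being a vertical line, directed upwards, that separates the two families of poles. By Cauchy's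
theorem the choice of the line is immaterial. This covers all parameters for which a separating line
exists, with `|arg z| < (m + n - (p + q) / 2) π`, which is the range of absolute convergence.
With `s = c + i t`, one has `(2πi)⁻¹ ds = (2π)⁻¹ dt`. -/
def meijerG (m n : ℕ) {p q : ℕ} (a : Fin p → ℂ) (b : Fin q → ℂ) (z : ℂ) : ℂ :=
  if h : ∃ c : ℝ, Separates m n a b c then
    (2 * (Real.pi : ℂ))⁻¹ *
      ∫ t : ℝ, meijerIntegrand m n a b z ((h.choose : ℂ) + (t : ℂ) * Complex.I)
  else 0

/-! ### Planar complex and symplectic ensembles -/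

/-- The two symmetry classes: complex (`β = 2`) and symplectic, or quaternionic (`β = 4`). -/
inductive SymmetryClass
  | complex
  | symplectic

/-- The Dyson index `β`. -/
def SymmetryClass.beta : SymmetryClass → ℕ
  | .complex => 2
  | .symplectic => 4

/-- The normalised area measure `dA = π⁻¹ d²z` on `ℂ`. -/
def areaMeasure : Measure ℂ := ENNReal.ofReal (Real.pi⁻¹) • (volume : Measure ℂ)

/-- The interaction factor of the joint density:
`∏_{j > k} |z_j - z_k|²` for `β = 2`, and
`∏_{j > k} |z_j - z_k|² |z_j - conj z_k|² ∏_j |z_j - conj z_j|²` for `β = 4`. -/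
def interaction (σ : SymmetryClass) {N : ℕ} (z : Fin N → ℂ) : ℝ :=
  match σ with
  | .complex => ∏ j : Fin N, ∏ k ∈ Finset.Iio j, ‖z j - z k‖ ^ 2
  | .symplectic =>
      (∏ j : Fin N, ∏ k ∈ Finset.Iio j,
          ‖z j - z k‖ ^ 2 * ‖z j - (starRingEnd ℂ) (z k)‖ ^ 2)
        * ∏ j : Fin N, ‖z j - (starRingEnd ℂ) (z j)‖ ^ 2

/-- The unnormalised joint density of `N` points in the external potential `Q`. -/
def jointWeight (σ : SymmetryClass) (N : ℕ) (Q : ℂ → ℝ) (z : Fin N → ℂ) : ℝ :=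
  interaction σ z * ∏ j : Fin N, Real.exp (-((N : ℝ) * Q (z j)))

/-- The partition function `Z_N`. -/
def partitionFunction (σ : SymmetryClass) (N : ℕ) (Q : ℂ → ℝ) : ℝ :=
  ∫ z, jointWeight σ N Q z ∂(Measure.pi fun _ : Fin N => areaMeasure)

/-- The joint law of the `N` points in the external potential `Q`. -/
def gibbsMeasure (σ : SymmetryClass) (N : ℕ) (Q : ℂ → ℝ) : Measure (Fin N → ℂ) :=
  (Measure.pi fun _ : Fin N => areaMeasure).withDensity
    fun z => ENNReal.ofReal (jointWeight σ N Q z / partitionFunction σ N Q)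

open Classical in
/-- The number of points in the open disc of radius `a` centred at the origin. -/
def pointCount {N : ℕ} (a : ℝ) (z : Fin N → ℂ) : ℝ :=
  ((Finset.univ.filter fun j : Fin N => ‖z j‖ < a).card : ℝ)

/-- The expected number `E_N(a)` of points in the disc of radius `a`. -/
def meanNumber (σ : SymmetryClass) (N : ℕ) (Q : ℂ → ℝ) (a : ℝ) : ℝ :=
  ∫ z, pointCount a z ∂(gibbsMeasure σ N Q)

/-- The number variance `V_N(a)`. -/
def numberVariance (σ : SymmetryClass) (N : ℕ) (Q : ℂ → ℝ) (a : ℝ) : ℝ :=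
  variance (fun z : Fin N → ℂ => pointCount a z) (gibbsMeasure σ N Q)

/-! ### Products of Ginibre matrices -/

/-- The potential of the product of `m` Ginibre matrices of size `N`,
`Q_N(z) = - (1/N) log G^{m,0}_{0,m}(-; 0,…,0 | (β N / 2)^m |z|²)`.
The G-function is real and positive for a positive argument; the value at the single point `z = 0`
is immaterial. -/
def productPotential (σ : SymmetryClass) (m N : ℕ) (z : ℂ) : ℝ :=
  -(1 / (N : ℝ)) * Real.log
    (meijerG m 0 (fun i : Fin 0 => i.elim0) (fun _ : Fin m => (0 : ℂ))
      (((((σ.beta : ℝ) / 2 * N) ^ m * ‖z‖ ^ 2 : ℝ)) : ℂ)).re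

/-- `G^{m,1}_{1,m+1}(1; k,…,k, 0 | x)`, with `k` repeated `m` times. -/
def meijerLower (m k : ℕ) (x : ℝ) : ℂ :=
  meijerG m 1 (fun _ : Fin 1 => (1 : ℂ))
    (Fin.snoc (α := fun _ => ℂ) (fun _ : Fin m => (k : ℂ)) 0) (x : ℂ)

/-- `G^{m+1,0}_{1,m+1}(1; 0, k,…,k | x)`, with `k` repeated `m` times. -/
def meijerUpper (m k : ℕ) (x : ℝ) : ℂ :=
  meijerG (m + 1) 0 (fun _ : Fin 1 => (1 : ℂ))
    (Fin.cons (α := fun _ => ℂ) 0 (fun _ : Fin m => (k : ℂ))) (x : ℂ)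

end PlanarEnsemble

end

noncomputable section

namespace PlanarEnsemble

open Set

/-! ### The Gamma function on vertical lines -/

/-! The number of points in a centred disc has the generating function of a sum of independent
Bernoulli variables whose parameters, at the scale `T / N ^ (m / 2)`, do not depend on `N`. The mean
and variance are then partial sums of fixed series.

Radial weight. The density `g` of a product of `m` independent exponential variables has Mellin
transform `Γ(s)^m`, so Mellin inversion identifies it with the G-function in the potential. Hence
`exp (-N Q_N(z)) = g (κ |z|²)` for `z ≠ 0`, with `κ = (βN/2)^m`.

Product formula. The interaction is a Vandermonde determinant times its conjugate (`β = 2`), or, up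
to sign, a Vandermonde determinant in the `2N` points `z_j, conj z_j` times `∏ (conj z_j - z_j)` (`β
= 4`). Expand it in monomials `∏ z_j^a_j (conj z_j)^b_j`. Against a radial weight only terms with `a
= b` survive, and in those the exponents are a permutation of `β/2 * j - 1`, `1 ≤ j ≤ N`
(`exists_monomial_expansion`). So the integral is a constant, the same for all weights, times a
product of radial moments (`exists_integral_interaction_mul`). Multiplying the weight by `t` inside
the disc yields `E[t^count] = ∏ (1 + (t - 1) p_j)`, where `p_j` is the ratio of a truncated moment
to a full one (`integral_pow_discCount`). Derivatives at `t = 1` give mean `∑ p_j` and variance `∑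
p_j (1 - p_j)`.

Limit. For the radius `a = T / N ^ (m / 2)`, `κ a² = (β/2)^m T²` is free of `N`. The bound `p_j ≤
x^l / l!`, with `l = β/2 * j - 1`, gives convergence. Finally `p_j` and `1 - p_j` are incomplete
moments of `g` over `(l!)^m`, and Mellin inversion identifies these moments with the G-functions of
the statement (`meijerLower_eq`, `meijerUpper_eq`). -/

theorem norm_Gamma_le_Gamma_re {s : ℂ} (hs : 0 < s.re) : ‖Complex.Gamma s‖ ≤ Real.Gamma s.re := by
  rw [Complex.Gamma_eq_integral hs, Complex.GammaIntegral, Real.Gamma_eq_integral hs]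
  refine (norm_integral_le_integral_norm _).trans (le_of_eq ?_)
  refine setIntegral_congr_fun measurableSet_Ioi fun x hx => ?_
  have hx : 0 < x := hx
  simp only [norm_mul, Complex.norm_real, Real.norm_eq_abs, abs_of_pos (Real.exp_pos _)]
  rw [Complex.norm_cpow_eq_rpow_re_of_pos hx]
  simp

/-- Since `Γ(s + 2) = (s + 1) s Γ(s)` and `|s|, |s + 1| ≥ |t|`, boundedness of `Γ` on the line `Re =
c + 2` becomes quadratic decay on `Re = c`. This suffices for absolute convergence of every contour
integral below. -/
theorem one_add_sq_mul_norm_Gamma_le {c : ℝ} (hc : 0 < c) (t : ℝ) :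
    (1 + t ^ 2) * ‖Complex.Gamma (c + t * Complex.I)‖ ≤ Real.Gamma c + Real.Gamma (c + 2) := by
  set s : ℂ := c + t * Complex.I with hs
  have hre : s.re = c := by simp [hs]
  have him : s.im = t := by simp [hs]
  have h0 : s ≠ 0 := fun h => by rw [h] at hre; simp at hre; linarith
  have h1 : s + 1 ≠ 0 := fun h => by
    have := congrArg Complex.re h
    rw [Complex.add_re, hre] at this; simp at this; linarith
  have e1 : Complex.Gamma (s + 2) = (s + 1) * (s * Complex.Gamma s) := by
    rw [show s + 2 = (s + 1) + 1 by ring, Complex.Gamma_add_one _ h1, Complex.Gamma_add_one _ h0]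
  have b1 := norm_Gamma_le_Gamma_re (s := s) (by linarith)
  have b2 := norm_Gamma_le_Gamma_re (s := s + 2) (by simp; linarith)
  rw [hre] at b1
  have hre2 : (s + 2).re = c + 2 := by simp [hre]
  rw [e1, norm_mul, norm_mul, ← mul_assoc, hre2] at b2
  have a1 : |t| ≤ ‖s‖ := him ▸ Complex.abs_im_le_norm s
  have a2 : |t| ≤ ‖s + 1‖ := by
    have := Complex.abs_im_le_norm (s + 1); simpa [him] using this
  have a3 : t ^ 2 ≤ ‖s + 1‖ * ‖s‖ := by
    rw [← sq_abs, sq]; exact mul_le_mul a2 a1 (abs_nonneg _) (norm_nonneg _)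
  have := mul_le_mul_of_nonneg_right a3 (norm_nonneg (Complex.Gamma s))
  linarith

theorem continuous_Gamma_vertical {c : ℝ} (hc : 0 < c) :
    Continuous fun t : ℝ => Complex.Gamma (c + t * Complex.I) := by
  rw [continuous_iff_continuousAt]
  intro t
  refine ContinuousAt.comp (g := Complex.Gamma) ?_ (by fun_prop)
  refine (Complex.differentiableAt_Gamma _ fun m h => ?_).continuousAt
  have := congrArg Complex.re h
  simp at this
  have hm : (0 : ℝ) ≤ m := Nat.cast_nonneg m
  linarith

theorem integrable_Gamma_pow_mul {c : ℝ} (hc : 0 < c) (n : ℕ) {h : ℝ → ℂ} (hh : Continuous h)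
    {C : ℝ} (hC : ∀ t, ‖h t‖ ≤ C) :
    Integrable fun t : ℝ => Complex.Gamma (c + t * Complex.I) ^ (n + 1) * h t := by
  have hC0 : 0 ≤ C := (norm_nonneg _).trans (hC 0)
  have hG := Real.Gamma_pos_of_pos hc
  have hG2 := Real.Gamma_pos_of_pos (show 0 < c + 2 by linarith)
  refine Integrable.mono' (g := fun t : ℝ =>
    (Real.Gamma c ^ n * (Real.Gamma c + Real.Gamma (c + 2)) * C) * (1 + t ^ 2)⁻¹)
    (integrable_inv_one_add_sq.const_mul _)
    (((continuous_Gamma_vertical hc).pow _).mul hh).aestronglyMeasurable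
    (Eventually.of_forall fun t => ?_)
  have b1 : ‖Complex.Gamma (c + t * Complex.I)‖ ≤ Real.Gamma c := by
    have := norm_Gamma_le_Gamma_re (s := c + t * Complex.I) (by simpa using hc)
    simpa using this
  have b2 : ‖Complex.Gamma (c + t * Complex.I)‖
      ≤ (Real.Gamma c + Real.Gamma (c + 2)) * (1 + t ^ 2)⁻¹ := by
    rw [← div_eq_mul_inv, le_div_iff₀ (by positivity), mul_comm]
    exact one_add_sq_mul_norm_Gamma_le hc t
  rw [norm_mul, norm_pow, pow_succ]
  calc _ ≤ Real.Gamma c ^ n * ((Real.Gamma c + Real.Gamma (c + 2)) * (1 + t ^ 2)⁻¹) * C := by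
        gcongr
        exact hC t
    _ = _ := by ring

/-! ### Mellin transforms of multiplicative convolutions -/

/-- Fubini and the substitution `x = t y`. -/
theorem hasMellin_mulConv {f h : ℝ → ℂ} (mf : Measurable f) (mh : Measurable h) {s : ℂ}
    (hf : MellinConvergent f s) (hh : MellinConvergent h s) :
    HasMellin (fun x => ∫ t in Ioi (0 : ℝ), f (x / t) * h t / t) s (mellin f s * mellin h s) := by
  set K : ℝ × ℝ → ℂ := fun p => (p.1 : ℂ) ^ (s - 1) * (f (p.1 / p.2) * h p.2 / p.2) with hK
  have hKm : AEStronglyMeasurable K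
      ((volume.restrict (Ioi (0 : ℝ))).prod (volume.restrict (Ioi (0 : ℝ)))) := by
    refine Measurable.aestronglyMeasurable ?_
    simp only [hK]
    fun_prop
  have hcomp : ∀ t : ℝ, 0 < t → MellinConvergent (fun x => f (x / t)) s := fun t ht => by
    have := (MellinConvergent.comp_mul_left (f := f) (s := s) (inv_pos.2 ht)).2 hf
    simpa only [div_eq_inv_mul] using this
  have hslice : ∀ t : ℝ, 0 < t → ∫ x in Ioi (0 : ℝ), K (x, t) =
      mellin f s * ((t : ℂ) ^ (s - 1) * h t) := fun t ht => by
    have h1 := mellin_comp_mul_left f s (inv_pos.2 ht)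
    have e : (fun x : ℝ => K (x, t)) =
        fun x : ℝ => ((x : ℂ) ^ (s - 1) * f (x / t)) * (h t / t) := by
      ext x; simp only [hK]; ring
    have e2 : ((t⁻¹ : ℝ) : ℂ) ^ (-s) = (t : ℂ) ^ (s - 1) * t := by
      rw [Complex.ofReal_inv, Complex.inv_cpow _ _ (by
        rw [Complex.arg_ofReal_of_nonneg ht.le]; exact Real.pi_pos.ne), Complex.cpow_neg, inv_inv]
      have ht0 : (t : ℂ) ≠ 0 := by simp [ht.ne']
      rw [Complex.cpow_sub _ _ ht0, Complex.cpow_one, div_mul_cancel₀ _ ht0]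
    rw [e, integral_mul_const]
    have e3 : ∫ x in Ioi (0 : ℝ), ((x : ℂ) ^ (s - 1) * f (x / t)) =
        mellin (fun x => f (t⁻¹ * x)) s := by
      simp only [mellin, smul_eq_mul, div_eq_inv_mul]
    rw [e3, h1, e2, smul_eq_mul]
    have : (t : ℂ) ≠ 0 := by simp [ht.ne']
    field_simp
  set M : ℝ := ∫ x in Ioi (0 : ℝ), x ^ (s.re - 1) * ‖f x‖ with hM
  -- The same substitution on norms: the slices integrate to a multiple of the norm of the Mellin
  -- integrand of `h`, so convergence of the two Mellin integrals gives joint integrability.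
  have hnorm : ∀ t : ℝ, 0 < t → ∫ x in Ioi (0 : ℝ), ‖K (x, t)‖ =
      M * ‖(t : ℂ) ^ (s - 1) • h t‖ := fun t ht => by
    have e : EqOn (fun x : ℝ => ‖K (x, t)‖)
        (fun x : ℝ => (fun y => (t * y) ^ (s.re - 1) * ‖f y‖ * (‖h t‖ / t)) (t⁻¹ * x))
        (Ioi 0) := fun x hx => by
      have hx : 0 < x := hx
      simp only [hK, norm_mul, norm_div, Complex.norm_cpow_eq_rpow_re_of_pos hx, Complex.norm_real,
        Real.norm_eq_abs, abs_of_pos ht, Complex.sub_re, Complex.one_re]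
      rw [mul_inv_cancel_left₀ ht.ne', ← div_eq_inv_mul]
      ring
    rw [setIntegral_congr_fun measurableSet_Ioi e, integral_comp_mul_left_Ioi
      (fun y => (t * y) ^ (s.re - 1) * ‖f y‖ * (‖h t‖ / t)) 0 (inv_pos.2 ht)]
    simp only [mul_zero, inv_inv, smul_eq_mul]
    rw [integral_mul_const, norm_mul, Complex.norm_cpow_eq_rpow_re_of_pos ht]
    have e2 : ∫ y in Ioi (0 : ℝ), (t * y) ^ (s.re - 1) * ‖f y‖ = t ^ (s.re - 1) * M := by
      rw [hM, ← integral_const_mul]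
      refine setIntegral_congr_fun measurableSet_Ioi fun y hy => ?_
      have hy : 0 < y := hy
      simp only [Real.mul_rpow ht.le hy.le]
      ring
    rw [e2, Complex.sub_re, Complex.one_re]
    field_simp
  have hInt : Integrable K
      ((volume.restrict (Ioi (0 : ℝ))).prod (volume.restrict (Ioi (0 : ℝ)))) := by
    rw [integrable_prod_iff' hKm]
    refine ⟨(ae_restrict_iff' measurableSet_Ioi).2 (Eventually.of_forall fun t ht => ?_), ?_⟩
    · have := (hcomp t ht).mul_const (h t / t)
      refine this.congr (Eventually.of_forall fun x => ?_)
      simp only [hK, smul_eq_mul]; ring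
    · refine IntegrableOn.congr_fun (f := fun t : ℝ => M * ‖(t : ℂ) ^ (s - 1) • h t‖)
        (hh.norm.const_mul M) (fun t ht => (hnorm t ht).symm) measurableSet_Ioi
  have hsw : ∀ x : ℝ, ∫ t in Ioi (0 : ℝ), K (x, t) =
      (x : ℂ) ^ (s - 1) • ∫ t in Ioi (0 : ℝ), f (x / t) * h t / t := fun x => by
    simp only [hK, smul_eq_mul]
    rw [integral_const_mul]
  constructor
  · have := hInt.integral_prod_left
    simp only [hsw] at this
    exact this
  · have := integral_integral_swap (f := fun x t => K (x, t)) hInt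
    simp only [hsw] at this
    rw [mellin, this, setIntegral_congr_fun measurableSet_Ioi fun t ht => hslice t ht,
      integral_const_mul]
    rfl

/-! ### The density of a product of independent exponential variables -/

/-- The density of the product of `n + 1` independent standard exponential variables. -/
def expProductDensity : ℕ → ℝ → ℝ
  | 0, x => Real.exp (-x)
  | n + 1, x => ∫ t in Ioi (0 : ℝ), expProductDensity n (x / t) * Real.exp (-t) / t

theorem measurable_expProductDensity (n : ℕ) : Measurable (expProductDensity n) := by
  induction n with
  | zero => exact Real.measurable_exp.comp measurable_neg
  | succ n ih =>
    have : StronglyMeasurable (Function.uncurry fun x t : ℝ =>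
        expProductDensity n (x / t) * Real.exp (-t) / t) := by
      refine Measurable.stronglyMeasurable ?_
      simp only [Function.uncurry_def]
      fun_prop
    exact this.integral_prod_right.measurable

theorem integrableOn_exp_neg : IntegrableOn (fun t : ℝ => Real.exp (-t)) (Ioi 0) := by
  simpa using integrableOn_exp_neg_Ioi 0

/-- The three claims share one induction. The bound `1 / x` reproduces itself because `∫ e^{-t} dt =
1`; it also dominates the convolution integrand by `e^{-t} / x`, which yields integrability and, by
dominated convergence, continuity. -/
theorem expProductDensity_basic (n : ℕ) :
    (∀ x, 0 < x → 0 < expProductDensity n x) ∧ (∀ x, 0 < x → expProductDensity n x ≤ 1 / x) ∧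
      ContinuousOn (expProductDensity n) (Ioi 0) := by
  induction n with
  | zero =>
    refine ⟨fun x _ => Real.exp_pos _, fun x hx => ?_, ?_⟩
    · rw [expProductDensity, Real.exp_neg, ← one_div]
      exact one_div_le_one_div_of_le hx (by linarith [Real.add_one_le_exp x])
    · exact (Real.continuous_exp.comp continuous_neg).continuousOn
  | succ n ih =>
    obtain ⟨hpos, hle, hcont⟩ := ih
    have hm := measurable_expProductDensity n
    have hb : ∀ x, 0 < x → ∀ t, 0 < t →
        ‖expProductDensity n (x / t) * Real.exp (-t) / t‖ ≤ 1 / x * Real.exp (-t) := by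
      intro x hx t ht
      have h1 := hpos _ (div_pos hx ht)
      rw [Real.norm_of_nonneg (by positivity)]
      have h2 := hle _ (div_pos hx ht)
      calc _ ≤ 1 / (x / t) * Real.exp (-t) / t := by gcongr
        _ = _ := by field_simp
    have hint : ∀ x, 0 < x → IntegrableOn
        (fun t => expProductDensity n (x / t) * Real.exp (-t) / t) (Ioi 0) := by
      intro x hx
      refine Integrable.mono' (integrableOn_exp_neg.const_mul (1 / x)) ?_ ?_
      · exact Measurable.aestronglyMeasurable (by fun_prop)
      · exact (ae_restrict_iff' measurableSet_Ioi).2 (Eventually.of_forall fun t ht => hb x hx t ht)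
    refine ⟨fun x hx => ?_, fun x hx => ?_, fun x hx => ?_⟩
    · rw [expProductDensity, setIntegral_pos_iff_support_of_nonneg_ae _ (hint x hx)]
      · refine lt_of_lt_of_le (b := volume (Ioi (0 : ℝ))) (by simp) (measure_mono fun t ht => ?_)
        have ht : 0 < t := ht
        have h1 := hpos _ (div_pos hx ht)
        exact ⟨by simp only [Function.mem_support]; positivity, ht⟩
      · refine (ae_restrict_iff' measurableSet_Ioi).2 (Eventually.of_forall fun t ht => ?_)
        have ht : 0 < t := ht
        have h1 := hpos _ (div_pos hx ht)
        simp only [Pi.zero_apply]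
        positivity
    · rw [expProductDensity]
      calc _ ≤ ∫ t in Ioi (0 : ℝ), 1 / x * Real.exp (-t) :=
            setIntegral_mono_on (hint x hx) (integrableOn_exp_neg.const_mul (1 / x))
              measurableSet_Ioi fun t ht => (le_abs_self _).trans (hb x hx t ht)
        _ = _ := by rw [integral_const_mul, integral_exp_neg_Ioi_zero, mul_one]
    · have hx : 0 < x := hx
      refine ContinuousAt.continuousWithinAt ?_
      refine continuousAt_of_dominated (bound := fun t => 1 / (x / 2) * Real.exp (-t)) ?_ ?_ ?_ ?_
      · exact Eventually.of_forall fun y => Measurable.aestronglyMeasurable (by fun_prop)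
      · filter_upwards [lt_mem_nhds (show x / 2 < x by linarith)] with y hy
        refine (ae_restrict_iff' measurableSet_Ioi).2 (Eventually.of_forall fun t ht => ?_)
        refine (hb y (by linarith) t ht).trans ?_
        gcongr
      · exact integrableOn_exp_neg.const_mul _
      · refine (ae_restrict_iff' measurableSet_Ioi).2 (Eventually.of_forall fun t ht => ?_)
        have ht : 0 < t := ht
        have h1 : ContinuousAt (expProductDensity n) (x / t) :=
          hcont.continuousAt (Ioi_mem_nhds (div_pos hx ht))
        have h2 : ContinuousAt (fun y => expProductDensity n (y / t)) x :=
          ContinuousAt.comp (f := fun y : ℝ => y / t) h1 (by fun_prop)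
        exact (h2.mul_const _).div_const _

theorem expProductDensity_pos (n : ℕ) {x : ℝ} (hx : 0 < x) : 0 < expProductDensity n x :=
  (expProductDensity_basic n).1 x hx

theorem continuousAt_expProductDensity (n : ℕ) {x : ℝ} (hx : 0 < x) :
    ContinuousAt (expProductDensity n) x :=
  (expProductDensity_basic n).2.2.continuousAt (Ioi_mem_nhds hx)

theorem hasMellin_expProductDensity (n : ℕ) {s : ℂ} (hs : 0 < s.re) :
    HasMellin (fun x => (expProductDensity n x : ℂ)) s (Complex.Gamma s ^ (n + 1)) := by
  have h0 : HasMellin (fun x => (Real.exp (-x) : ℂ)) s (Complex.Gamma s) := by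
    constructor
    · refine (Complex.GammaIntegral_convergent hs).congr (Eventually.of_forall fun x => ?_)
      simp [mul_comm]
    · rw [Complex.Gamma_eq_integral hs, Complex.GammaIntegral_eq_mellin]
  induction n with
  | zero => simpa only [expProductDensity, zero_add, pow_one] using h0
  | succ n ih =>
    have hm := measurable_expProductDensity n
    have := hasMellin_mulConv (by fun_prop) (by fun_prop) ih.1 h0.1
    rw [ih.2, h0.2, ← pow_succ] at this
    convert this using 2 with x
    rw [expProductDensity, ← integral_complex_ofReal]
    refine integral_congr_ae (Eventually.of_forall fun t => ?_)
    push_cast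
    rfl

/-! ### Evaluation of Meijer G-functions by Mellin inversion -/

/-- Mellin inversion along `Re = -c`. The line in `meijerG` is an unspecified choice, so the
hypotheses are required on every separating line; this replaces any contour shift. -/
theorem meijerG_eq_of_mellin {m n p q : ℕ} {a : Fin p → ℂ} {b : Fin q → ℂ} {x : ℝ} (hx : 0 < x)
    {F : ℝ → ℂ} (hF : ContinuousAt F x) (hex : ∃ c : ℝ, Separates m n a b c)
    (H : ∀ c : ℝ, Separates m n a b c →
      MellinConvergent F ((-c : ℝ) : ℂ) ∧ Complex.VerticalIntegrable (mellin F) (-c) ∧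
        ∀ t : ℝ, meijerIntegrand m n a b x (c + t * Complex.I) =
          (x : ℂ) ^ (c + t * Complex.I) * mellin F (-(c + t * Complex.I))) :
    meijerG m n a b x = F x := by
  rw [meijerG, dif_pos hex]
  obtain ⟨h1, h2, h3⟩ := H _ hex.choose_spec
  rw [← mellinInv_mellin_eq _ F hx h1 h2 hF, mellinInv, Complex.real_smul]
  have e : ((1 / (2 * Real.pi) : ℝ) : ℂ) = (2 * (Real.pi : ℂ))⁻¹ := by push_cast; simp
  rw [← e]
  congr 1
  -- The G-function uses `x^s` and Mellin inversion `x^{-s}`, hence the reflection `t ↦ -t`.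
  rw [← integral_neg_eq_self]
  refine integral_congr_ae (Eventually.of_forall fun t => ?_)
  simp only [h3, smul_eq_mul]
  congr 2 <;> push_cast <;> ring

theorem meijerG_expProductDensity (n : ℕ) {x : ℝ} (hx : 0 < x) :
    meijerG (n + 1) 0 (fun i : Fin 0 => i.elim0) (fun _ : Fin (n + 1) => (0 : ℂ)) (x : ℂ) =
      expProductDensity n x := by
  refine meijerG_eq_of_mellin hx (F := fun y => (expProductDensity n y : ℂ))
    (Complex.continuous_ofReal.continuousAt.comp (continuousAt_expProductDensity n hx))
    ⟨-1, by simp [Separates]⟩ fun c hc => ?_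
  have hc0 : c < 0 := by simpa using hc.1 0 (by simp)
  refine ⟨(hasMellin_expProductDensity n (by simpa using hc0)).1, ?_, fun t => ?_⟩
  · have := integrable_Gamma_pow_mul (c := -c) (by linarith) n
      (continuous_const (y := (1 : ℂ))) (C := 1) (by simp)
    refine this.congr (Eventually.of_forall fun t => ?_)
    simp only [mul_one]
    rw [(hasMellin_expProductDensity n (by simpa using hc0)).2]
  · rw [(hasMellin_expProductDensity n (by simpa using hc0)).2]
    simp only [meijerIntegrand, Fin.is_lt, if_true, Finset.prod_const, Finset.card_univ,
      Fintype.card_fin, Finset.univ_eq_empty, Finset.prod_empty, mul_one, zero_sub]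

/-! ### Incomplete moments -/

/-- The incomplete moment `∫_0^x t^l g(t) dt`. -/
def lowerMoment (n l : ℕ) (x : ℝ) : ℝ := ∫ t in Ioo 0 x, t ^ l * expProductDensity n t

/-- The complementary moment `∫_x^∞ t^l g(t) dt`. -/
def upperMoment (n l : ℕ) (x : ℝ) : ℝ := ∫ t in Ici x, t ^ l * expProductDensity n t

theorem integrableOn_moment (n l : ℕ) :
    IntegrableOn (fun t : ℝ => t ^ l * expProductDensity n t) (Ioi 0) := by
  have h := (hasMellin_expProductDensity n (s := (l : ℂ) + 1) (by simp; positivity)).1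
  rw [MellinConvergent] at h
  refine IntegrableOn.congr_fun h.re (fun t ht => ?_) measurableSet_Ioi
  simp only [add_sub_cancel_right, Complex.cpow_natCast, smul_eq_mul]
  norm_cast

theorem integral_moment (n l : ℕ) :
    ∫ t in Ioi (0 : ℝ), t ^ l * expProductDensity n t = (l.factorial : ℝ) ^ (n + 1) := by
  have h := (hasMellin_expProductDensity n (s := (l : ℂ) + 1) (by simp; positivity)).2
  rw [Complex.Gamma_nat_eq_factorial, mellin] at h
  have : ((∫ t in Ioi (0 : ℝ), t ^ l * expProductDensity n t : ℝ) : ℂ) =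
      ((l.factorial : ℝ) ^ (n + 1) : ℝ) := by
    rw [← integral_complex_ofReal]
    push_cast
    rw [← h]
    simp only [add_sub_cancel_right, Complex.cpow_natCast, smul_eq_mul]
  exact_mod_cast this

theorem lowerMoment_add_upperMoment (n l : ℕ) {x : ℝ} (hx : 0 < x) :
    lowerMoment n l x + upperMoment n l x = (l.factorial : ℝ) ^ (n + 1) := by
  have hI := integrableOn_moment n l
  rw [lowerMoment, upperMoment, ← integral_moment, ← Ioo_union_Ici_eq_Ioi hx,
    setIntegral_union _ measurableSet_Ici (hI.mono_set fun t ht => ht.1)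
      (hI.mono_set fun t ht => lt_of_lt_of_le hx ht)]
  rw [Set.disjoint_left]
  exact fun t h1 h2 => absurd h1.2 (not_lt.2 h2)

theorem moment_nonneg_of_pos (n l : ℕ) {t : ℝ} (ht : 0 < t) : 0 ≤ t ^ l * expProductDensity n t := by
  have := expProductDensity_pos n ht
  positivity

theorem lowerMoment_nonneg (n l : ℕ) (x : ℝ) : 0 ≤ lowerMoment n l x :=
  setIntegral_nonneg measurableSet_Ioo fun _ ht => moment_nonneg_of_pos n l ht.1

theorem upperMoment_nonneg (n l : ℕ) {x : ℝ} (hx : 0 < x) : 0 ≤ upperMoment n l x :=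
  setIntegral_nonneg measurableSet_Ici fun _ ht => moment_nonneg_of_pos n l (hx.trans_le ht)

theorem continuousAt_lowerMoment (n l : ℕ) {x : ℝ} (hx : 0 < x) :
    ContinuousAt (lowerMoment n l) x := by
  have hI := (integrable_indicator_iff measurableSet_Ioi).2 (integrableOn_moment n l)
  have hc := intervalIntegral.continuous_primitive (fun a b => hI.intervalIntegrable (a := a) (b := b)) 0
  refine hc.continuousAt.congr ?_
  filter_upwards [lt_mem_nhds hx] with y hy
  rw [intervalIntegral.integral_of_le hy.le, lowerMoment, ← integral_Ioc_eq_integral_Ioo]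
  refine setIntegral_congr_fun measurableSet_Ioc fun t ht => ?_
  rw [indicator_of_mem (by exact ht.1)]

theorem continuousAt_upperMoment (n l : ℕ) {x : ℝ} (hx : 0 < x) :
    ContinuousAt (upperMoment n l) x := by
  have : ContinuousAt (fun y => (l.factorial : ℝ) ^ (n + 1) - lowerMoment n l y) x :=
    continuousAt_const.sub (continuousAt_lowerMoment n l hx)
  refine this.congr ?_
  filter_upwards [lt_mem_nhds hx] with y hy
  rw [← lowerMoment_add_upperMoment n l hy]
  ring

theorem hasMellin_one_Ioi {s : ℂ} (hs : s.re < 0) :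
    HasMellin (indicator (Ioi (1 : ℝ)) fun _ => (1 : ℂ)) s (-1 / s) := by
  have e : (fun t : ℝ => (t : ℂ) ^ (s - 1) • indicator (Ioi (1 : ℝ)) (fun _ => (1 : ℂ)) t) =
      indicator (Ioi (1 : ℝ)) fun t : ℝ => (t : ℂ) ^ (s - 1) := by
    ext t
    by_cases ht : t ∈ Ioi (1 : ℝ) <;> simp [ht]
  have hre : (s - 1).re < -1 := by simp; linarith
  have hsub : Ioi (0 : ℝ) ∩ Ioi 1 = Ioi 1 :=
    inter_eq_right.2 (Ioi_subset_Ioi zero_le_one)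
  constructor
  · rw [MellinConvergent, e, IntegrableOn, integrable_indicator_iff measurableSet_Ioi, IntegrableOn,
      Measure.restrict_restrict measurableSet_Ioi, inter_comm, hsub]
    exact integrableOn_Ioi_cpow_of_lt hre one_pos
  · rw [mellin, e, setIntegral_indicator measurableSet_Ioi, hsub,
      integral_Ioi_cpow_of_lt hre one_pos]
    simp

theorem hasMellin_moment (n l : ℕ) {s : ℂ} (hs : -(l + 1 : ℝ) < s.re) :
    HasMellin (fun t => (t : ℂ) ^ ((l : ℂ) + 1) • (expProductDensity n t : ℂ)) s
      (Complex.Gamma (s + (l + 1)) ^ (n + 1)) := by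
  have h := hasMellin_expProductDensity n (s := s + (l + 1)) (by simp; linarith)
  exact ⟨MellinConvergent.cpow_smul.2 h.1, by rw [mellin_cpow_smul, h.2]⟩

theorem hasMellin_congr {f g : ℝ → ℂ} {s v : ℂ} (hf : HasMellin f s v)
    (hfg : EqOn f g (Ioi 0)) : HasMellin g s v := by
  constructor
  · exact IntegrableOn.congr_fun hf.1 (fun t ht => by simp only [hfg ht]) measurableSet_Ioi
  · rw [← hf.2, mellin, mellin]
    exact setIntegral_congr_fun measurableSet_Ioi fun t ht => by simp only [hfg ht]

/-- The lower moment is the multiplicative convolution of the indicator of `(1, ∞)` with `t^{l+1}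
g(t)`; the extra power of `t` compensates the `dt / t`. The two factors have a common strip of
convergence, the one assumed here. -/
theorem hasMellin_lowerMoment (n l : ℕ) {s : ℂ} (hs : -(l + 1 : ℝ) < s.re) (hs0 : s.re < 0) :
    HasMellin (fun x => (lowerMoment n l x : ℂ)) s
      (Complex.Gamma (s + (l + 1)) ^ (n + 1) * (-1 / s)) := by
  have hm := measurable_expProductDensity n
  have h1 := hasMellin_one_Ioi hs0
  have h2 := hasMellin_moment n l hs
  have h := hasMellin_mulConv ((measurable_const).indicator measurableSet_Ioi)
    (by simp only [smul_eq_mul]; fun_prop) h1.1 h2.1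
  rw [h1.2, h2.2, mul_comm] at h
  refine hasMellin_congr h fun x hx => ?_
  have hx : 0 < x := hx
  rw [lowerMoment, ← integral_complex_ofReal]
  have e : EqOn (fun t : ℝ => indicator (Ioi (1 : ℝ)) (fun _ => (1 : ℂ)) (x / t) *
        ((t : ℂ) ^ ((l : ℂ) + 1) • (expProductDensity n t : ℂ)) / t)
      (indicator (Ioo 0 x) fun t => ((t ^ l * expProductDensity n t : ℝ) : ℂ)) (Ioi 0) := by
    intro t ht
    have ht : 0 < t := ht
    have ht' : (t : ℂ) ≠ 0 := by simp [ht.ne']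
    by_cases h : t < x
    · have h' : x / t ∈ Ioi (1 : ℝ) := (one_lt_div ht).2 h
      simp only [indicator_of_mem h', indicator_of_mem (show t ∈ Ioo 0 x from ⟨ht, h⟩)]
      rw [Complex.cpow_add _ _ ht', Complex.cpow_natCast, Complex.cpow_one]
      push_cast
      simp only [smul_eq_mul]
      field_simp
    · have h' : x / t ∉ Ioi (1 : ℝ) := fun hh => h ((one_lt_div ht).1 hh)
      simp only [indicator_of_notMem h', indicator_of_notMem (show t ∉ Ioo 0 x from fun hh => h hh.2)]
      simp
  rw [setIntegral_congr_fun measurableSet_Ioi e, setIntegral_indicator measurableSet_Ioo,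
    inter_eq_right.2 (fun t ht => ht.1)]

/-- As for the lower moment, with the indicator of `(0, 1]`, which moves the strip to `Re s > 0`. -/
theorem hasMellin_upperMoment (n l : ℕ) {s : ℂ} (hs : 0 < s.re) :
    HasMellin (fun x => (upperMoment n l x : ℂ)) s
      (Complex.Gamma (s + (l + 1)) ^ (n + 1) * (1 / s)) := by
  have hm := measurable_expProductDensity n
  have h1 := hasMellin_one_Ioc hs
  have hl : (0 : ℝ) ≤ l := Nat.cast_nonneg l
  have h2 := hasMellin_moment n l (s := s) (by linarith)
  have h := hasMellin_mulConv ((measurable_const).indicator measurableSet_Ioc)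
    (by simp only [smul_eq_mul]; fun_prop) h1.1 h2.1
  rw [h1.2, h2.2, mul_comm] at h
  refine hasMellin_congr h fun x hx => ?_
  have hx : 0 < x := hx
  rw [upperMoment, ← integral_complex_ofReal]
  have e : EqOn (fun t : ℝ => indicator (Ioc (0 : ℝ) 1) (fun _ => (1 : ℂ)) (x / t) *
        ((t : ℂ) ^ ((l : ℂ) + 1) • (expProductDensity n t : ℂ)) / t)
      (indicator (Ici x) fun t => ((t ^ l * expProductDensity n t : ℝ) : ℂ)) (Ioi 0) := by
    intro t ht
    have ht : 0 < t := ht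
    have ht' : (t : ℂ) ≠ 0 := by simp [ht.ne']
    by_cases h : x ≤ t
    · have h' : x / t ∈ Ioc (0 : ℝ) 1 := ⟨div_pos hx ht, (div_le_one ht).2 h⟩
      simp only [indicator_of_mem h', indicator_of_mem (show t ∈ Ici x from h)]
      rw [Complex.cpow_add _ _ ht', Complex.cpow_natCast, Complex.cpow_one]
      push_cast
      simp only [smul_eq_mul]
      field_simp
    · have h' : x / t ∉ Ioc (0 : ℝ) 1 := fun hh => h ((div_le_one ht).1 hh.2)
      simp only [indicator_of_notMem h', indicator_of_notMem (show t ∉ Ici x from h)]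
      simp
  rw [setIntegral_congr_fun measurableSet_Ioi e, setIntegral_indicator measurableSet_Ici,
    inter_eq_right.2 (show Ici x ⊆ Ioi 0 from fun t ht => lt_of_lt_of_le hx ht)]

theorem integrable_Gamma_pow_mul_inv {c σ : ℝ} (hc : 0 < c) (hσ : σ ≠ 0) (n : ℕ) (v : ℂ) :
    Integrable fun t : ℝ => Complex.Gamma (c + t * Complex.I) ^ (n + 1) *
      (v / (σ + t * Complex.I)) := by
  have hne : ∀ t : ℝ, (σ : ℂ) + t * Complex.I ≠ 0 := fun t h => hσ (by
    simpa using congrArg Complex.re h)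
  refine integrable_Gamma_pow_mul hc n (C := ‖v‖ / |σ|)
    (continuous_const.div (by fun_prop) hne) fun t => ?_
  rw [norm_div]
  have := Complex.abs_re_le_norm ((σ : ℂ) + t * Complex.I)
  simp only [Complex.add_re, Complex.ofReal_re, Complex.mul_re, Complex.I_re, Complex.I_im,
    Complex.ofReal_im, mul_zero, zero_mul, sub_zero, add_zero] at this
  have h0 : 0 < |σ| := abs_pos.2 hσ
  gcongr

theorem meijerLower_eq (n l : ℕ) {x : ℝ} (hx : 0 < x) :
    meijerLower (n + 1) (l + 1) x = lowerMoment n l x := by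
  have hl : (0 : ℝ) ≤ l := Nat.cast_nonneg l
  have hsep : ∀ c : ℝ, Separates (n + 1) 1 (fun _ : Fin 1 => (1 : ℂ))
      (Fin.snoc (α := fun _ => ℂ) (fun _ : Fin (n + 1) => ((l + 1 : ℕ) : ℂ)) 0) c ↔
        c < l + 1 ∧ 0 < c := by
    intro c
    refine ⟨fun h => ⟨?_, by simpa using h.2 0 (by simp)⟩, fun h => ⟨fun j hj => ?_, by simpa using h.2⟩⟩
    · have := h.1 (Fin.castSucc 0) (by simp)
      simpa only [Fin.snoc_castSucc, Nat.cast_add, Nat.cast_one, Complex.add_re,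
        Complex.natCast_re, Complex.one_re] using this
    · rw [show j = Fin.castSucc ⟨j, hj⟩ from rfl]
      simpa only [Fin.snoc_castSucc, Nat.cast_add, Nat.cast_one, Complex.add_re,
        Complex.natCast_re, Complex.one_re] using h.1
  refine meijerG_eq_of_mellin hx (F := fun y => (lowerMoment n l y : ℂ))
    (Complex.continuous_ofReal.continuousAt.comp (continuousAt_lowerMoment n l hx))
    ⟨1 / 2, (hsep _).2 ⟨by linarith, by norm_num⟩⟩ fun c hc => ?_
  obtain ⟨hc1, hc0⟩ := (hsep c).1 hc
  have hM : ∀ t : ℝ, HasMellin (fun x => (lowerMoment n l x : ℂ)) (-(c + t * Complex.I)) _ :=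
    fun t => hasMellin_lowerMoment n l (by simp; linarith) (by simp; linarith)
  refine ⟨by simpa using (hM 0).1, ?_, fun t => ?_⟩
  · have := integrable_Gamma_pow_mul_inv (c := -c + (l + 1)) (σ := -c) (by linarith) (by linarith)
      n (-1)
    refine this.congr (Eventually.of_forall fun t => ?_)
    have h := (hM (-t)).2
    simp only
    rw [show ((-c : ℝ) : ℂ) + t * Complex.I = -(c + ((-t : ℝ) : ℂ) * Complex.I) by push_cast; ring, h]
    congr 3
    push_cast; ring
  · rw [(hM t).2, meijerIntegrand, Fin.prod_univ_castSucc]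
    have hs : (c : ℂ) + t * Complex.I ≠ 0 := fun h => hc0.ne' (by
      simpa using congrArg Complex.re h)
    have hg : Complex.Gamma (c + t * Complex.I) ≠ 0 := Complex.Gamma_ne_zero_of_re_pos (by simpa)
    -- The pair `a = 1`, `b = 0` contributes `Γ(s) / Γ(1 + s) = 1 / s`, the transform of the
    -- indicator.
    have hg1 : Complex.Gamma (1 + (c + t * Complex.I)) =
        (c + t * Complex.I) * Complex.Gamma (c + t * Complex.I) := by
      rw [add_comm, Complex.Gamma_add_one _ hs]
    simp only [Fin.snoc_castSucc, Fin.val_castSucc, Fin.is_lt, if_true, Fin.snoc_last, Fin.val_last,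
      lt_irrefl, if_false, Finset.prod_const, Finset.card_univ, Fintype.card_fin, sub_zero,
      sub_self, zero_add, hg1]
    rw [show -((c : ℂ) + t * Complex.I) + (l + 1) = ((l + 1 : ℕ) : ℂ) - (c + t * Complex.I) by
      push_cast; ring]
    field_simp

theorem meijerUpper_eq (n l : ℕ) {x : ℝ} (hx : 0 < x) :
    meijerUpper (n + 1) (l + 1) x = upperMoment n l x := by
  have hl : (0 : ℝ) ≤ l := Nat.cast_nonneg l
  have hsep : ∀ c : ℝ, Separates (n + 1 + 1) 0 (fun _ : Fin 1 => (1 : ℂ))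
      (Fin.cons (α := fun _ => ℂ) 0 (fun _ : Fin (n + 1) => ((l + 1 : ℕ) : ℂ))) c ↔ c < 0 := by
    intro c
    refine ⟨fun h => by simpa using h.1 0 (by simp), fun h => ⟨fun j _ => ?_, by simp⟩⟩
    refine Fin.cases ?_ (fun i => ?_) j
    · simpa using h
    · simp only [Fin.cons_succ, Nat.cast_add, Nat.cast_one, Complex.add_re,
        Complex.natCast_re, Complex.one_re]
      linarith
  refine meijerG_eq_of_mellin hx (F := fun y => (upperMoment n l y : ℂ))
    (Complex.continuous_ofReal.continuousAt.comp (continuousAt_upperMoment n l hx))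
    ⟨-1, (hsep _).2 (by norm_num)⟩ fun c hc => ?_
  have hc0 := (hsep c).1 hc
  have hM : ∀ t : ℝ, HasMellin (fun x => (upperMoment n l x : ℂ)) (-(c + t * Complex.I)) _ :=
    fun t => hasMellin_upperMoment n l (by simp; linarith)
  refine ⟨by simpa using (hM 0).1, ?_, fun t => ?_⟩
  · have := integrable_Gamma_pow_mul_inv (c := -c + (l + 1)) (σ := -c) (by linarith) (by linarith)
      n 1
    refine this.congr (Eventually.of_forall fun t => ?_)
    have h := (hM (-t)).2
    simp only
    rw [show ((-c : ℝ) : ℂ) + t * Complex.I = -(c + ((-t : ℝ) : ℂ) * Complex.I) by push_cast; ring, h]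
    congr 3
    push_cast; ring
  · rw [(hM t).2, meijerIntegrand, Fin.prod_univ_succ]
    have hs : (c : ℂ) + t * Complex.I ≠ 0 := fun h => hc0.ne (by
      simpa using congrArg Complex.re h)
    have hg : Complex.Gamma (-(c + t * Complex.I)) ≠ 0 :=
      Complex.Gamma_ne_zero_of_re_pos (by simpa)
    have hg1 : Complex.Gamma (1 - (c + t * Complex.I)) =
        -(c + t * Complex.I) * Complex.Gamma (-(c + t * Complex.I)) := by
      rw [sub_eq_neg_add, Complex.Gamma_add_one _ (neg_ne_zero.2 hs)]
    simp only [Fin.cons_succ, Fin.val_succ, add_lt_add_iff_right, Fin.is_lt, if_true, Fin.cons_zero,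
      lt_irrefl, if_false, Finset.prod_const, Finset.card_univ, Fintype.card_fin, zero_sub,
      Fin.prod_univ_one, Fin.val_zero, Nat.zero_lt_succ, hg1]
    rw [show -((c : ℂ) + t * Complex.I) + (l + 1) = ((l + 1 : ℕ) : ℂ) - (c + t * Complex.I) by
      push_cast; ring]
    field_simp

/-! ### Monomial expansion of the interaction -/

theorem prod_Iio_eq_prod_Ioi {M : Type*} [CommMonoid M] {N : ℕ} (f : Fin N → Fin N → M) :
    ∏ j, ∏ k ∈ Finset.Iio j, f j k = ∏ k, ∏ j ∈ Finset.Ioi k, f j k :=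
  Finset.prod_comm' (by simp)

theorem prod_Ioi_eq_prod_ite {M : Type*} [CommMonoid M] {N : ℕ} (i : Fin N) (f : Fin N → M) :
    ∏ j ∈ Finset.Ioi i, f j = ∏ j, if i < j then f j else 1 := by
  rw [← Finset.prod_filter, Finset.filter_lt_eq_Ioi]

theorem prod_prod_eq_prod_Ioi_mul_diag {M : Type*} [CommMonoid M] {N : ℕ} (f : Fin N → Fin N → M) :
    ∏ i, ∏ j, f i j = (∏ i, ∏ j ∈ Finset.Ioi i, f i j * f j i) * ∏ i, f i i := by
  have e : ∀ i j, f i j = ((if i < j then f i j else 1) * (if j < i then f i j else 1)) *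
      (if i = j then f i j else 1) := fun i j => by
    rcases lt_trichotomy i j with h | h | h
    · simp [h, h.ne, h.not_gt]
    · simp [h]
    · simp [h, h.ne', h.not_gt]
  have h1 : ∏ i, ∏ j, (if j < i then f i j else 1) = ∏ i, ∏ j ∈ Finset.Ioi i, f j i := by
    rw [← prod_Iio_eq_prod_Ioi]
    refine Finset.prod_congr rfl fun i _ => ?_
    rw [← Finset.prod_filter, Finset.filter_gt_eq_Iio]
  calc _ = ∏ i, ∏ j, (((if i < j then f i j else 1) * (if j < i then f i j else 1)) *
      (if i = j then f i j else 1)) :=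
        Finset.prod_congr rfl fun i _ => Finset.prod_congr rfl fun j _ => e i j
    _ = _ := by
      simp only [Finset.prod_mul_distrib, h1, Finset.prod_ite_eq, Finset.mem_univ, if_true,
        ← prod_Ioi_eq_prod_ite]

theorem det_vandermonde_eq_sum {n : ℕ} (v : Fin n → ℂ) :
    (Matrix.vandermonde v).det =
      ∑ ρ : Equiv.Perm (Fin n), ((Equiv.Perm.sign ρ : ℤ) : ℂ) * ∏ i, v i ^ (ρ i : ℕ) := by
  rw [← Matrix.det_transpose, Matrix.det_apply']
  simp only [Matrix.transpose_apply, Matrix.vandermonde_apply]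

theorem interaction_complex_eq {N : ℕ} (z : Fin N → ℂ) :
    (interaction .complex z : ℂ) =
      (Matrix.vandermonde z).det * (starRingEnd ℂ) (Matrix.vandermonde z).det := by
  rw [Matrix.det_vandermonde, interaction, prod_Iio_eq_prod_Ioi]
  simp only [map_prod, Complex.ofReal_prod, ← Finset.prod_mul_distrib, Complex.mul_conj',
    Complex.ofReal_pow]

theorem det_vandermonde_append {N : ℕ} (z w : Fin N → ℂ) :
    (Matrix.vandermonde (Fin.append z w)).det =
      (∏ i, ∏ j ∈ Finset.Ioi i, (z j - z i)) * (∏ i, ∏ j, (w j - z i)) *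
        ∏ i, ∏ j ∈ Finset.Ioi i, (w j - w i) := by
  have hlt : ∀ i j : Fin N, Fin.castAdd N i < Fin.natAdd N j := fun i j => by
    rw [Fin.lt_def]; simp; omega
  simp only [Matrix.det_vandermonde, prod_Ioi_eq_prod_ite, Fin.prod_univ_add, Fin.append_left,
    Fin.append_right, Finset.prod_mul_distrib, hlt, if_true, (hlt _ _).not_gt, if_false,
    Finset.prod_const_one]
  simp only [Fin.lt_def, Fin.val_castAdd, Fin.val_natAdd, add_lt_add_iff_left]
  ring

/-- The Vandermonde determinant of the points and their conjugates contains `∏ (conj z_i - z_i)`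
only once; the second copy is the extra factor. -/
theorem interaction_symplectic_eq {N : ℕ} (z : Fin N → ℂ) :
    (interaction .symplectic z : ℂ) =
      ((∏ i : Fin N, ∏ _j ∈ Finset.Ioi i, (-1 : ℂ)) * ∏ _i : Fin N, (-1 : ℂ)) *
        ((Matrix.vandermonde (Fin.append z fun i => (starRingEnd ℂ) (z i))).det *
          ∏ i, ((starRingEnd ℂ) (z i) - z i)) := by
  rw [det_vandermonde_append, prod_prod_eq_prod_Ioi_mul_diag, interaction, prod_Iio_eq_prod_Ioi]
  have e : ∀ a b : ℂ, ((‖a - b‖ ^ 2 : ℝ) : ℂ) =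
      (a - b) * ((starRingEnd ℂ) a - (starRingEnd ℂ) b) := fun a b => by
    rw [← map_sub, Complex.mul_conj']; push_cast; rfl
  simp only [Complex.ofReal_mul, Complex.ofReal_prod, e, Complex.conj_conj]
  have h1 : ∏ i, ∏ j ∈ Finset.Ioi i, ((z j - z i) * ((starRingEnd ℂ) (z j) - (starRingEnd ℂ) (z i)) *
        ((z j - (starRingEnd ℂ) (z i)) * ((starRingEnd ℂ) (z j) - z i))) =
      (∏ i : Fin N, ∏ _j ∈ Finset.Ioi i, (-1 : ℂ)) * ((∏ i, ∏ j ∈ Finset.Ioi i, (z j - z i)) *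
      (∏ i, ∏ j ∈ Finset.Ioi i, ((starRingEnd ℂ) (z j) - z i) * ((starRingEnd ℂ) (z i) - z j)) *
      ∏ i, ∏ j ∈ Finset.Ioi i, ((starRingEnd ℂ) (z j) - (starRingEnd ℂ) (z i))) := by
    simp only [← Finset.prod_mul_distrib]
    refine Finset.prod_congr rfl fun i _ => Finset.prod_congr rfl fun j _ => ?_
    ring
  have h2 : ∏ i, ((z i - (starRingEnd ℂ) (z i)) * ((starRingEnd ℂ) (z i) - z i)) =
      (∏ _i : Fin N, (-1 : ℂ)) * ((∏ i, ((starRingEnd ℂ) (z i) - z i)) *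
        ∏ i, ((starRingEnd ℂ) (z i) - z i)) := by
    simp only [← Finset.prod_mul_distrib]
    refine Finset.prod_congr rfl fun i _ => ?_
    ring
  rw [h1, h2]
  ring

/-- A permutation of `2N` letters that sends each pair `(j, N + j)` to neighbours sends it to
`{2k, 2k + 1}` for some `k`. -/
theorem exists_perm_of_neighbours {N : ℕ} (ρ : Equiv.Perm (Fin (N + N)))
    (h : ∀ j : Fin N, (ρ (Fin.castAdd N j) : ℕ) = ρ (Fin.natAdd N j) + 1 ∨
      (ρ (Fin.castAdd N j) : ℕ) + 1 = ρ (Fin.natAdd N j)) :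
    ∃ τ : Equiv.Perm (Fin N), ∀ j : Fin N,
      max (ρ (Fin.castAdd N j) : ℕ) (ρ (Fin.natAdd N j)) = 2 * (τ j : ℕ) + 1 := by
  set u : Fin N → ℕ := fun j => ρ (Fin.castAdd N j) with hu
  set v : Fin N → ℕ := fun j => ρ (Fin.natAdd N j) with hv
  have hu1 : ∀ i j, u i = u j → i = j := fun i j hij =>
    Fin.castAdd_injective N N (ρ.injective (Fin.ext hij))
  have hv1 : ∀ i j, v i = v j → i = j := fun i j hij =>
    Fin.natAdd_injective N N (ρ.injective (Fin.ext hij))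
  have huv : ∀ i j, u i ≠ v j := fun i j hij => by
    have := congrArg Fin.val (ρ.injective (Fin.ext hij))
    simp at this; omega
  have hlt : ∀ j, u j < N + N ∧ v j < N + N := fun j => ⟨Fin.is_lt _, Fin.is_lt _⟩
  have hsurj : ∀ k, k < N + N → ∃ j, u j = k ∨ v j = k := fun k hk => by
    obtain ⟨i, hi⟩ := ρ.surjective ⟨k, hk⟩
    refine Fin.addCases (motive := fun i => ρ i = ⟨k, hk⟩ → ∃ j, u j = k ∨ v j = k)
      (fun j hj => ⟨j, Or.inl ?_⟩) (fun j hj => ⟨j, Or.inr ?_⟩) i hi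
    · simp only [hu, hj]
    · simp only [hv, hj]
  have h' : ∀ j, u j = v j + 1 ∨ u j + 1 = v j := h
  -- Pairs fill up from below: the partner of `2k + 2` cannot be `2k + 1`, already the partner of
  -- `2k`, so it is `2k + 3`.
  have key : ∀ k j, (u j = 2 * k → v j = 2 * k + 1) ∧ (v j = 2 * k → u j = 2 * k + 1) := by
    intro k
    induction k with
    | zero =>
      intro j
      have := h' j
      omega
    | succ k ih =>
      intro j
      have hj := h' j
      have hl := hlt j
      constructor
      · intro e
        by_contra hne
        obtain ⟨i, hi | hi⟩ := hsurj (2 * k) (by omega)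
        · have := (ih i).1 hi
          have := hv1 i j (by omega)
          subst this
          omega
        · have := (ih i).2 hi
          exact huv i j (by omega)
      · intro e
        by_contra hne
        obtain ⟨i, hi | hi⟩ := hsurj (2 * k) (by omega)
        · have := (ih i).1 hi
          exact huv j i (by omega)
        · have := (ih i).2 hi
          have := hu1 i j (by omega)
          subst this
          omega
  have key' : ∀ j, (u j = 2 * (u j / 2) ∧ v j = 2 * (u j / 2) + 1) ∨
      (v j = 2 * (u j / 2) ∧ u j = 2 * (u j / 2) + 1) := fun j => by
    have hj := h' j
    have h1 := key (u j / 2) j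
    have h2 := key (v j / 2) j
    omega
  have hinj : Function.Injective fun j : Fin N => (⟨u j / 2, by have := (hlt j).1; omega⟩ : Fin N) := by
    intro i j hij
    have hij : u i / 2 = u j / 2 := congrArg Fin.val hij
    have h1 := key' i
    have h2 := key' j
    have h3 := huv i j
    by_cases h4 : u i = u j
    · exact hu1 i j h4
    · omega
  refine ⟨Equiv.ofBijective _ (Finite.injective_iff_bijective.1 hinj), fun j => ?_⟩
  have h1 := key' j
  simp only [Equiv.ofBijective_apply]
  change max (u j) (v j) = _
  omega

/-- For `β = 4`, the factor `conj z_j - z_j` raises one of the exponents `ρ(j)`, `ρ(N + j)` by one.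
Equality afterwards means that they were neighbours, and the common exponent is the larger one, `2
τ(j) + 1`. -/
theorem exists_monomial_expansion (σ : SymmetryClass) (N : ℕ) :
    ∃ (ι : Type) (_ : Fintype ι) (c : ι → ℂ) (a b : ι → Fin N → ℕ),
      (∀ z : Fin N → ℂ, (interaction σ z : ℂ) =
        ∑ i, c i * ∏ j, (z j ^ a i j * (starRingEnd ℂ) (z j) ^ b i j)) ∧
      ∀ i, (∀ j, a i j = b i j) →
        ∃ τ : Equiv.Perm (Fin N), ∀ j, a i j = σ.beta / 2 * (τ j + 1) - 1 := by
  cases σ with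
  | complex =>
    refine ⟨Equiv.Perm (Fin N) × Equiv.Perm (Fin N), inferInstance,
      fun ρ => ((Equiv.Perm.sign ρ.1 : ℤ) : ℂ) * ((Equiv.Perm.sign ρ.2 : ℤ) : ℂ),
      fun ρ j => ρ.1 j, fun ρ j => ρ.2 j, fun z => ?_, fun ρ _ => ⟨ρ.1, fun j => ?_⟩⟩
    · rw [interaction_complex_eq, det_vandermonde_eq_sum, map_sum, Finset.sum_mul_sum,
        Fintype.sum_prod_type]
      refine Finset.sum_congr rfl fun ρ _ => Finset.sum_congr rfl fun ρ' _ => ?_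
      simp only [map_mul, map_prod, map_pow, Finset.prod_mul_distrib, map_intCast]
      ring
    · simp [SymmetryClass.beta]
  | symplectic =>
    refine ⟨Equiv.Perm (Fin (N + N)) × (Fin N → Bool), inferInstance,
      fun p => ((∏ i : Fin N, ∏ _j ∈ Finset.Ioi i, (-1 : ℂ)) * ∏ _i : Fin N, (-1 : ℂ)) *
        (((Equiv.Perm.sign p.1 : ℤ) : ℂ) * ∏ j, if p.2 j then 1 else -1),
      fun p j => p.1 (Fin.castAdd N j) + if p.2 j then 0 else 1,
      fun p j => p.1 (Fin.natAdd N j) + if p.2 j then 1 else 0, fun z => ?_, fun p hp => ?_⟩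
    · have hprod : ∏ i, ((starRingEnd ℂ) (z i) - z i) =
          ∑ s : Fin N → Bool, ∏ j, (if s j then (starRingEnd ℂ) (z j) else -z j) := by
        have := Finset.prod_univ_sum (fun _ : Fin N => (Finset.univ : Finset Bool))
          (fun j t => if t then (starRingEnd ℂ) (z j) else -z j)
        rw [Fintype.piFinset_univ] at this
        rw [← this]
        refine Finset.prod_congr rfl fun j _ => ?_
        simp [sub_eq_add_neg]
      rw [interaction_symplectic_eq, det_vandermonde_eq_sum, hprod, Finset.sum_mul_sum,
        Finset.mul_sum, Fintype.sum_prod_type]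
      refine Finset.sum_congr rfl fun ρ _ => ?_
      rw [Finset.mul_sum]
      refine Finset.sum_congr rfl fun s _ => ?_
      simp only [Fin.prod_univ_add, Fin.append_left, Fin.append_right]
      simp only [mul_assoc, ← Finset.prod_mul_distrib]
      congr 4
      funext j
      by_cases hs : s j = true <;> simp [hs, pow_succ] <;> ring
    · obtain ⟨τ, hτ⟩ := exists_perm_of_neighbours p.1 fun j => by
        have := hp j
        cases hs : p.2 j <;> simp only [hs, Bool.false_eq_true, if_true, if_false] at this <;>
          omega
      refine ⟨τ, fun j => ?_⟩
      have h1 := hτ j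
      have h2 := hp j
      simp only [SymmetryClass.beta]
      cases hs : p.2 j <;> simp only [hs, Bool.false_eq_true, if_true, if_false] at h2 ⊢ <;> omega

/-! ### Integration against radial weights -/

instance : areaMeasure.IsAddHaarMeasure :=
  Measure.IsAddHaarMeasure.smul _ (by simp [Real.pi_pos]) ENNReal.ofReal_ne_top

/-- All moments of the radial weight `z ↦ φ ‖z‖` are finite. -/
def HasRadialMoments (φ : ℝ → ℝ) : Prop :=
  ∀ l : ℕ, Integrable (fun z : ℂ => ‖z‖ ^ l * φ ‖z‖) areaMeasure

/-- The even moments of a radial weight. -/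
def radialMoment (φ : ℝ → ℝ) (l : ℕ) : ℝ := ∫ z : ℂ, ‖z‖ ^ (2 * l) * φ ‖z‖ ∂areaMeasure

theorem HasRadialMoments.integrable_monomial {φ : ℝ → ℝ} (hφ : HasRadialMoments φ) (a b : ℕ) :
    Integrable (fun z : ℂ => z ^ a * (starRingEnd ℂ) z ^ b * (φ ‖z‖ : ℂ)) areaMeasure := by
  have h0 := hφ 0
  simp only [pow_zero, one_mul] at h0
  refine (hφ (a + b)).mono ?_ (Eventually.of_forall fun z => ?_)
  · exact ((by fun_prop : Continuous fun z : ℂ => z ^ a * (starRingEnd ℂ) z ^ b).aestronglyMeasurable).mul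
      h0.ofReal.aestronglyMeasurable
  · simp [pow_add]

theorem integral_monomial {φ : ℝ → ℝ} (a b : ℕ) :
    ∫ z : ℂ, z ^ a * (starRingEnd ℂ) z ^ b * (φ ‖z‖ : ℂ) ∂areaMeasure =
      if a = b then (radialMoment φ a : ℂ) else 0 := by
  split_ifs with h
  · subst h
    rw [radialMoment, ← integral_complex_ofReal]
    refine integral_congr_ae (Eventually.of_forall fun z => ?_)
    simp only [← mul_pow, Complex.mul_conj', pow_mul]
    push_cast
    rfl
  -- Rotation by this angle multiplies the integrand by `e^{iπ} = -1` and preserves the measure.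
  · set θ : ℝ := Real.pi / ((a : ℝ) - b)
    have hab : (a : ℝ) - b ≠ 0 := sub_ne_zero.2 (by exact_mod_cast h)
    set u : Circle := Circle.exp θ with hu
    have hpow : (u : ℂ) ^ a * (starRingEnd ℂ) (u : ℂ) ^ b = -1 := by
      rw [hu, Circle.coe_exp, ← Complex.exp_conj, ← Complex.exp_nat_mul, ← Complex.exp_nat_mul,
        ← Complex.exp_add, ← Complex.exp_pi_mul_I]
      congr 1
      simp only [map_mul, Complex.conj_ofReal, Complex.conj_I]
      have : ((θ * (a - b) : ℝ) : ℂ) = (Real.pi : ℝ) := by rw [div_mul_cancel₀ _ hab]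
      push_cast at this
      linear_combination Complex.I * this
    have hmp : MeasurePreserving (rotation u) areaMeasure areaMeasure :=
      (LinearIsometryEquiv.measurePreserving (rotation u)).smul_measure _
    have hI := hmp.integral_comp (rotation u).toHomeomorph.measurableEmbedding
      (fun z : ℂ => z ^ a * (starRingEnd ℂ) z ^ b * (φ ‖z‖ : ℂ))
    have e : ∀ z : ℂ, (rotation u z) ^ a * (starRingEnd ℂ) (rotation u z) ^ b *
        (φ ‖rotation u z‖ : ℂ) = -(z ^ a * (starRingEnd ℂ) z ^ b * (φ ‖z‖ : ℂ)) := fun z => by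
      rw [LinearIsometryEquiv.norm_map, rotation_apply, map_mul, mul_pow, mul_pow]
      linear_combination (z ^ a * (starRingEnd ℂ) z ^ b * (φ ‖z‖ : ℂ)) * hpow
    simp only [e, integral_neg] at hI
    exact self_eq_neg.1 hI.symm

theorem integrable_interaction_mul (σ : SymmetryClass) (N : ℕ) {φ : ℝ → ℝ}
    (hφ : HasRadialMoments φ) :
    Integrable (fun z : Fin N → ℂ => interaction σ z * ∏ j, φ ‖z j‖)
      (Measure.pi fun _ => areaMeasure) := by
  obtain ⟨ι, _, c, a, b, hexp, -⟩ := exists_monomial_expansion σ N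
  have : Integrable (fun z : Fin N → ℂ => ((interaction σ z * ∏ j, φ ‖z j‖ : ℝ) : ℂ))
      (Measure.pi fun _ => areaMeasure) := by
    push_cast
    simp only [hexp, Finset.sum_mul, mul_assoc, ← Finset.prod_mul_distrib]
    refine integrable_finsetSum _ fun i _ => Integrable.const_mul ?_ _
    refine Integrable.fintype_prod (f := fun j z => z ^ a i j * ((starRingEnd ℂ) z ^ b i j *
      (φ ‖z‖ : ℂ))) fun j => ?_
    simpa only [mul_assoc] using hφ.integrable_monomial (a i j) (b i j)
  exact this.re

/-- The constant is quantified before the weight: it cancels in ratios, so its value is never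
needed. -/
theorem exists_integral_interaction_mul (σ : SymmetryClass) (N : ℕ) :
    ∃ C : ℝ, ∀ φ : ℝ → ℝ, HasRadialMoments φ →
      ∫ z : Fin N → ℂ, interaction σ z * ∏ j, φ ‖z j‖ ∂(Measure.pi fun _ => areaMeasure) =
        C * ∏ i : Fin N, radialMoment φ (σ.beta / 2 * (i + 1) - 1) := by
  classical
  obtain ⟨ι, _, c, a, b, hexp, hperm⟩ := exists_monomial_expansion σ N
  have key : ∀ φ : ℝ → ℝ, HasRadialMoments φ →
      ((∫ z : Fin N → ℂ, interaction σ z * ∏ j, φ ‖z j‖ ∂(Measure.pi fun _ => areaMeasure) : ℝ) : ℂ)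
        = (∑ i, if ∀ j, a i j = b i j then c i else 0) *
          ((∏ i : Fin N, radialMoment φ (σ.beta / 2 * (i + 1) - 1) : ℝ) : ℂ) := by
    intro φ hφ
    rw [← integral_complex_ofReal]
    push_cast
    simp only [hexp, Finset.sum_mul, mul_assoc, ← Finset.prod_mul_distrib]
    have hint : ∀ i, Integrable (fun z : Fin N → ℂ =>
        ∏ j, (z j ^ a i j * ((starRingEnd ℂ) (z j) ^ b i j * (φ ‖z j‖ : ℂ))))
        (Measure.pi fun _ => areaMeasure) := fun i => by
      refine Integrable.fintype_prod (f := fun j z => z ^ a i j * ((starRingEnd ℂ) z ^ b i j *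
        (φ ‖z‖ : ℂ))) fun j => ?_
      simpa only [mul_assoc] using hφ.integrable_monomial (a i j) (b i j)
    rw [integral_finsetSum _ fun i _ => (hint i).const_mul _]
    refine Finset.sum_congr rfl fun i _ => ?_
    rw [integral_const_mul, integral_fintype_prod_eq_prod
      (f := fun j z => z ^ a i j * ((starRingEnd ℂ) z ^ b i j * (φ ‖z‖ : ℂ)))]
    simp only [← mul_assoc, integral_monomial]
    split_ifs with h
    · obtain ⟨τ, hτ⟩ := hperm i h
      simp only [h, if_true]
      simp only [← h, hτ]
      rw [Equiv.prod_comp τ (fun k : Fin N =>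
        (radialMoment φ (σ.beta / 2 * (k + 1) - 1) : ℂ))]
    · push Not at h
      obtain ⟨j, hj⟩ := h
      rw [Finset.prod_eq_zero (Finset.mem_univ j) (if_neg hj)]
      simp
  refine ⟨(∑ i, if ∀ j, a i j = b i j then c i else 0).re, fun φ hφ => ?_⟩
  have := congrArg Complex.re (key φ hφ)
  rw [Complex.re_mul_ofReal] at this
  simpa using this

theorem continuous_interaction (σ : SymmetryClass) (N : ℕ) :
    Continuous fun z : Fin N → ℂ => interaction σ z := by
  cases σ <;> unfold interaction <;> fun_prop

theorem interaction_nonneg (σ : SymmetryClass) {N : ℕ} (z : Fin N → ℂ) : 0 ≤ interaction σ z := by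
  cases σ <;> unfold interaction <;> positivity

theorem exists_interaction_ne_zero (σ : SymmetryClass) (N : ℕ) :
    ∃ z : Fin N → ℂ, interaction σ z ≠ 0 := by
  have h1 : ∀ j k : Fin N, j ≠ k → ((j : ℂ) + 1) * Complex.I - (k + 1) * Complex.I ≠ 0 := by
    intro j k hjk h
    have := congrArg Complex.im h
    simp [sub_eq_zero] at this
    exact hjk (Fin.ext this)
  have h2 : ∀ j k : Fin N, ((j : ℂ) + 1) * Complex.I -
      (starRingEnd ℂ) (((k : ℂ) + 1) * Complex.I) ≠ 0 := by
    intro j k h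
    have := congrArg Complex.im h
    simp at this
    have h3 : (0 : ℝ) ≤ (j : ℕ) := Nat.cast_nonneg _
    have h4 : (0 : ℝ) ≤ (k : ℕ) := Nat.cast_nonneg _
    linarith
  -- Distinct points of the open upper half-plane, hence also distinct from all the conjugates.
  refine ⟨fun j => ((j : ℂ) + 1) * Complex.I, ?_⟩
  cases σ <;> unfold interaction
  · refine Finset.prod_ne_zero_iff.2 fun j _ => Finset.prod_ne_zero_iff.2 fun k hk => ?_
    exact pow_ne_zero _ (norm_ne_zero_iff.2 (h1 j k (Finset.mem_Iio.1 hk).ne'))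
  · refine mul_ne_zero (Finset.prod_ne_zero_iff.2 fun j _ => Finset.prod_ne_zero_iff.2 fun k hk =>
      mul_ne_zero ?_ ?_) (Finset.prod_ne_zero_iff.2 fun j _ => ?_)
    · exact pow_ne_zero _ (norm_ne_zero_iff.2 (h1 j k (Finset.mem_Iio.1 hk).ne'))
    · exact pow_ne_zero _ (norm_ne_zero_iff.2 (h2 j k))
    · exact pow_ne_zero _ (norm_ne_zero_iff.2 (h2 j j))

theorem integral_interaction_mul_pos (σ : SymmetryClass) (N : ℕ) {φ : ℝ → ℝ}
    (hφ : HasRadialMoments φ) (hpos : ∀ r, 0 < φ r) :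
    0 < ∫ z : Fin N → ℂ, interaction σ z * ∏ j, φ ‖z j‖ ∂(Measure.pi fun _ => areaMeasure) := by
  have hP : ∀ z : Fin N → ℂ, 0 < ∏ j, φ ‖z j‖ := fun z => Finset.prod_pos fun j _ => hpos _
  rw [integral_pos_iff_support_of_nonneg
    (fun z => mul_nonneg (interaction_nonneg σ z) (hP z).le) (integrable_interaction_mul σ N hφ)]
  have hs : Function.support (fun z : Fin N → ℂ => interaction σ z * ∏ j, φ ‖z j‖) =
      {z | interaction σ z ≠ 0} := by
    ext z
    simp [(hP z).ne']
  rw [hs]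
  exact (isOpen_ne_fun (continuous_interaction σ N) continuous_const).measure_pos _
    (exists_interaction_ne_zero σ N)

/-! ### Mean and variance from a generating function -/

theorem eval_one_derivatives_prod {ι : Type*} (s : Finset ι) (p : ι → ℝ) :
    ∀ P : Polynomial ℝ, P = ∏ i ∈ s, (1 + (Polynomial.X - 1) * Polynomial.C (p i)) →
      P.eval 1 = 1 ∧ (Polynomial.derivative P).eval 1 = ∑ i ∈ s, p i ∧
      (Polynomial.derivative (Polynomial.derivative P)).eval 1 =
        (∑ i ∈ s, p i) ^ 2 - ∑ i ∈ s, p i ^ 2 := by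
  classical
  induction s using Finset.induction_on with
  | empty => rintro P rfl; simp
  | insert i s hi ih =>
    rintro P rfl
    obtain ⟨h0, h1, h2⟩ := ih _ rfl
    rw [Finset.prod_insert hi, Finset.sum_insert hi, Finset.sum_insert hi]
    set A := ∏ i ∈ s, (1 + (Polynomial.X - 1) * Polynomial.C (p i))
    simp only [Polynomial.derivative_mul, Polynomial.derivative_add, Polynomial.derivative_sub,
      Polynomial.derivative_one, Polynomial.derivative_X, Polynomial.derivative_C,
      Polynomial.eval_add, Polynomial.eval_mul, Polynomial.eval_sub, Polynomial.eval_one,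
      Polynomial.eval_X, Polynomial.eval_C, h0, h1, h2, Polynomial.eval_zero,
      Polynomial.derivative_zero]
    refine ⟨by ring, by ring, by ring⟩

/-- At `t = 1` the first two derivatives give the sums of `q l * l` and `q l * l (l - 1)`. -/
theorem moments_of_generating_function {N : ℕ} (q : ℕ → ℝ) (p : Fin N → ℝ)
    (h : ∀ t : ℝ, ∑ l ∈ Finset.range (N + 1), q l * t ^ l = ∏ i, (1 + (t - 1) * p i)) :
    ∑ l ∈ Finset.range (N + 1), q l * l = ∑ i, p i ∧
      ∑ l ∈ Finset.range (N + 1), q l * (l : ℝ) ^ 2 = ∑ i, p i + (∑ i, p i) ^ 2 - ∑ i, p i ^ 2 := by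
  set P : Polynomial ℝ := ∑ l ∈ Finset.range (N + 1), Polynomial.C (q l) * Polynomial.X ^ l with hP
  have hPQ : P = ∏ i, (1 + (Polynomial.X - 1) * Polynomial.C (p i)) := by
    refine Polynomial.funext fun t => ?_
    simp [hP, Polynomial.eval_finsetSum, Polynomial.eval_prod, h]
  obtain ⟨-, h1, h2⟩ := eval_one_derivatives_prod Finset.univ p P hPQ
  have e1 : (Polynomial.derivative P).eval 1 = ∑ l ∈ Finset.range (N + 1), q l * l := by
    simp [hP, Polynomial.eval_finsetSum, Polynomial.derivative_X_pow]
  have e2 : (Polynomial.derivative (Polynomial.derivative P)).eval 1 =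
      ∑ l ∈ Finset.range (N + 1), q l * ((l : ℝ) ^ 2 - l) := by
    simp only [hP, map_sum, Polynomial.eval_finsetSum]
    refine Finset.sum_congr rfl fun l _ => ?_
    rcases l with _ | l
    · simp
    · simp only [Polynomial.derivative_C_mul_X_pow, Polynomial.eval_mul, Polynomial.eval_C,
        Polynomial.eval_pow, Polynomial.eval_X, one_pow, mul_one, Nat.add_sub_cancel]
      push_cast
      ring
  rw [← e1, h1]
  refine ⟨rfl, ?_⟩
  have e3 : ∑ l ∈ Finset.range (N + 1), q l * (l : ℝ) ^ 2 =
      ∑ l ∈ Finset.range (N + 1), q l * ((l : ℝ) ^ 2 - l) +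
        ∑ l ∈ Finset.range (N + 1), q l * l := by
    rw [← Finset.sum_add_distrib]
    exact Finset.sum_congr rfl fun l _ => by ring
  rw [e3, ← e1, ← e2, h1, h2]
  ring

/-! ### The law of the number of points in a disc -/

open Classical in
/-- The number of points in a disc, as a natural number. -/
def discCount {N : ℕ} (a : ℝ) (z : Fin N → ℂ) : ℕ :=
  (Finset.univ.filter fun j : Fin N => ‖z j‖ < a).card

theorem pointCount_eq {N : ℕ} (a : ℝ) (z : Fin N → ℂ) : pointCount a z = discCount a z := rfl

theorem discCount_le {N : ℕ} (a : ℝ) (z : Fin N → ℂ) : discCount a z ≤ N := by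
  classical
  exact (Finset.card_le_univ _).trans_eq (Fintype.card_fin N)

theorem measurable_discCount {N : ℕ} (a : ℝ) :
    Measurable fun z : Fin N → ℂ => discCount a z := by
  classical
  simp only [discCount, Finset.card_filter]
  refine Finset.measurable_fun_sum _ fun j _ => Measurable.ite ?_ measurable_const measurable_const
  exact measurableSet_lt (by fun_prop) measurable_const

theorem pow_discCount {N : ℕ} (a t : ℝ) (z : Fin N → ℂ) :
    t ^ discCount a z = ∏ j, if ‖z j‖ < a then t else 1 := by
  classical
  rw [Finset.prod_ite, Finset.prod_const, Finset.prod_const_one, mul_one, discCount]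

theorem integral_comp_discCount {N : ℕ} (μ : Measure (Fin N → ℂ)) [IsFiniteMeasure μ] (a : ℝ)
    (g : ℕ → ℝ) :
    ∫ z, g (discCount a z) ∂μ =
      ∑ l ∈ Finset.range (N + 1), μ.real {z | discCount a z = l} * g l := by
  have hm : ∀ l, MeasurableSet {z : Fin N → ℂ | discCount a z = l} := fun l =>
    measurable_discCount a (measurableSet_singleton l)
  have e : ∀ z : Fin N → ℂ, g (discCount a z) = ∑ l ∈ Finset.range (N + 1),
      Set.indicator {z | discCount a z = l} (fun _ => g l) z := fun z => by
    simp only [Set.indicator_apply, Set.mem_ofPred_eq]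
    rw [Finset.sum_ite_eq, if_pos (Finset.mem_range_succ_iff.2 (discCount_le a z))]
  simp only [e]
  rw [integral_finsetSum _ fun l _ => (integrable_const (g l)).indicator (hm l)]
  refine Finset.sum_congr rfl fun l _ => ?_
  rw [integral_indicator_const _ (hm l), smul_eq_mul]

/-- The truncation of a radial weight to the disc of radius `a`. -/
def truncatedWeight (φ : ℝ → ℝ) (a r : ℝ) : ℝ := if r < a then φ r else 0

theorem HasRadialMoments.truncated {φ : ℝ → ℝ} (hφ : HasRadialMoments φ) (a : ℝ) :
    HasRadialMoments (truncatedWeight φ a) := fun l => by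
  refine ((hφ l).indicator (measurableSet_ball (x := (0 : ℂ)) (ε := a))).congr
    (Eventually.of_forall fun z => ?_)
  simp only [Set.indicator, mem_ball_zero_iff, truncatedWeight, mul_ite, mul_zero]

section Gibbs

variable {σ : SymmetryClass} {N : ℕ} {Q : ℂ → ℝ} {φ : ℝ → ℝ}

/-- An almost everywhere hypothesis suffices, so the value of the potential at the origin plays no
role. -/
theorem jointWeight_ae_eq
    (hQ : ∀ᵐ z ∂areaMeasure, Real.exp (-((N : ℝ) * Q z)) = φ ‖z‖) :
    jointWeight σ N Q =ᵐ[Measure.pi fun _ : Fin N => areaMeasure]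
      fun z => interaction σ z * ∏ j, φ ‖z j‖ := by
  have : ∀ᵐ z : Fin N → ℂ ∂(Measure.pi fun _ => areaMeasure),
      ∀ j, Real.exp (-((N : ℝ) * Q (z j))) = φ ‖z j‖ :=
    ae_all_iff.2 fun j =>
      (Measure.quasiMeasurePreserving_eval (fun _ : Fin N => areaMeasure) j).ae hQ
  filter_upwards [this] with z hz
  simp only [jointWeight, hz]

theorem partitionFunction_eq
    (hQ : ∀ᵐ z ∂areaMeasure, Real.exp (-((N : ℝ) * Q z)) = φ ‖z‖) :
    partitionFunction σ N Q =
      ∫ z : Fin N → ℂ, interaction σ z * ∏ j, φ ‖z j‖ ∂(Measure.pi fun _ => areaMeasure) :=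
  integral_congr_ae (jointWeight_ae_eq hQ)

theorem partitionFunction_pos (hφ : HasRadialMoments φ) (hpos : ∀ r, 0 < φ r)
    (hQ : ∀ᵐ z ∂areaMeasure, Real.exp (-((N : ℝ) * Q z)) = φ ‖z‖) :
    0 < partitionFunction σ N Q := by
  rw [partitionFunction_eq hQ]
  exact integral_interaction_mul_pos σ N hφ hpos

theorem integrable_jointWeight_div (hφ : HasRadialMoments φ)
    (hQ : ∀ᵐ z ∂areaMeasure, Real.exp (-((N : ℝ) * Q z)) = φ ‖z‖) :
    Integrable (fun z => jointWeight σ N Q z / partitionFunction σ N Q)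
      (Measure.pi fun _ : Fin N => areaMeasure) :=
  ((integrable_interaction_mul σ N hφ).congr (jointWeight_ae_eq hQ).symm).div_const _

theorem jointWeight_nonneg (σ : SymmetryClass) (N : ℕ) (Q : ℂ → ℝ) (z : Fin N → ℂ) :
    0 ≤ jointWeight σ N Q z :=
  mul_nonneg (interaction_nonneg σ z) (Finset.prod_nonneg fun _ _ => (Real.exp_pos _).le)

theorem isProbabilityMeasure_gibbsMeasure (hφ : HasRadialMoments φ) (hpos : ∀ r, 0 < φ r)
    (hQ : ∀ᵐ z ∂areaMeasure, Real.exp (-((N : ℝ) * Q z)) = φ ‖z‖) :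
    IsProbabilityMeasure (gibbsMeasure σ N Q) := by
  have hZ := partitionFunction_pos (σ := σ) hφ hpos hQ
  refine ⟨?_⟩
  rw [gibbsMeasure, withDensity_apply _ MeasurableSet.univ, Measure.restrict_univ,
    ← ofReal_integral_eq_lintegral_ofReal (integrable_jointWeight_div hφ hQ)
      (Eventually.of_forall fun z => div_nonneg (jointWeight_nonneg σ N Q z) hZ.le),
    integral_div]
  change ENNReal.ofReal (partitionFunction σ N Q / partitionFunction σ N Q) = 1
  rw [div_self hZ.ne', ENNReal.ofReal_one]

theorem integral_gibbsMeasure (hφ : HasRadialMoments φ) (hpos : ∀ r, 0 < φ r)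
    (hQ : ∀ᵐ z ∂areaMeasure, Real.exp (-((N : ℝ) * Q z)) = φ ‖z‖) (F : (Fin N → ℂ) → ℝ) :
    ∫ z, F z ∂(gibbsMeasure σ N Q) =
      (∫ z : Fin N → ℂ, (interaction σ z * ∏ j, φ ‖z j‖) * F z
        ∂(Measure.pi fun _ => areaMeasure)) / partitionFunction σ N Q := by
  have hZ := partitionFunction_pos (σ := σ) hφ hpos hQ
  rw [gibbsMeasure, integral_withDensity_eq_integral_toReal_smul₀
    (integrable_jointWeight_div hφ hQ).aestronglyMeasurable.aemeasurable.ennreal_ofReal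
    (Eventually.of_forall fun z => ENNReal.ofReal_lt_top), ← integral_div]
  refine integral_congr_ae ?_
  filter_upwards [jointWeight_ae_eq (σ := σ) hQ] with z hz
  rw [ENNReal.toReal_ofReal (div_nonneg (jointWeight_nonneg σ N Q z) hZ.le), hz, smul_eq_mul]
  ring

theorem integral_pow_discCount (hφ : HasRadialMoments φ) (hpos : ∀ r, 0 < φ r)
    (hQ : ∀ᵐ z ∂areaMeasure, Real.exp (-((N : ℝ) * Q z)) = φ ‖z‖) (a t : ℝ) :
    ∫ z, t ^ discCount a z ∂(gibbsMeasure σ N Q) =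
      ∏ i : Fin N, (1 + (t - 1) * (radialMoment (truncatedWeight φ a) (σ.beta / 2 * (i + 1) - 1) /
        radialMoment φ (σ.beta / 2 * (i + 1) - 1))) := by
  obtain ⟨C, hC⟩ := exists_integral_interaction_mul σ N
  have hZ := partitionFunction_pos (σ := σ) hφ hpos hQ
  have hφa := hφ.truncated a
  set φt : ℝ → ℝ := fun r => φ r + (t - 1) * truncatedWeight φ a r with hφt
  have hφt_eq : ∀ r, φt r = φ r * if r < a then t else 1 := fun r => by
    simp only [hφt, truncatedWeight]
    split_ifs <;> ring
  have hsplit : ∀ (l : ℕ) (z : ℂ), ‖z‖ ^ l * φt ‖z‖ =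
      ‖z‖ ^ l * φ ‖z‖ + (t - 1) * (‖z‖ ^ l * truncatedWeight φ a ‖z‖) := fun l z => by
    simp only [hφt]; ring
  have hφtm : HasRadialMoments φt := fun l => by
    simp only [hsplit]
    exact (hφ l).add ((hφa l).const_mul _)
  have hmom : ∀ l, radialMoment φt l =
      radialMoment φ l + (t - 1) * radialMoment (truncatedWeight φ a) l := fun l => by
    simp only [radialMoment, hsplit]
    rw [integral_add (hφ _) ((hφa _).const_mul _), integral_const_mul]
  have hZe := (partitionFunction_eq (σ := σ) hQ).trans (hC φ hφ)
  -- Positivity of the partition function makes every factor in its product formula nonzero.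
  have hne : ∀ i : Fin N, radialMoment φ (σ.beta / 2 * (i + 1) - 1) ≠ 0 := fun i h => by
    rw [hZe, Finset.prod_eq_zero (Finset.mem_univ i) h, mul_zero] at hZ
    exact lt_irrefl _ hZ
  have hC0 : C ≠ 0 := fun h => by
    rw [hZe, h, zero_mul] at hZ
    exact lt_irrefl _ hZ
  rw [integral_gibbsMeasure hφ hpos hQ]
  have e : ∀ z : Fin N → ℂ, (interaction σ z * ∏ j, φ ‖z j‖) * t ^ discCount a z =
      interaction σ z * ∏ j, φt ‖z j‖ := fun z => by
    simp only [pow_discCount, hφt_eq, Finset.prod_mul_distrib, mul_assoc]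
  simp only [e]
  rw [hC φt hφtm, hZe, mul_div_mul_left _ _ hC0, ← Finset.prod_div_distrib]
  refine Finset.prod_congr rfl fun i _ => ?_
  rw [hmom, add_div, div_self (hne i), mul_div_assoc]

theorem meanNumber_and_numberVariance_eq (hφ : HasRadialMoments φ) (hpos : ∀ r, 0 < φ r)
    (hQ : ∀ᵐ z ∂areaMeasure, Real.exp (-((N : ℝ) * Q z)) = φ ‖z‖) (a : ℝ) {p : ℕ → ℝ}
    (hp : ∀ i, p i = radialMoment (truncatedWeight φ a) (σ.beta / 2 * (i + 1) - 1) /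
        radialMoment φ (σ.beta / 2 * (i + 1) - 1)) :
    meanNumber σ N Q a = ∑ i ∈ Finset.range N, p i ∧
      numberVariance σ N Q a = ∑ i ∈ Finset.range N, p i * (1 - p i) := by
  have := isProbabilityMeasure_gibbsMeasure (σ := σ) hφ hpos hQ
  set μ := gibbsMeasure σ N Q
  obtain ⟨h1, h2⟩ := moments_of_generating_function
    (fun l => μ.real {z | discCount a z = l}) (fun i : Fin N => p i) fun t => by
      rw [← integral_comp_discCount μ a (fun l => t ^ l), integral_pow_discCount hφ hpos hQ]
      simp only [hp]
  rw [← integral_comp_discCount μ a (fun l => (l : ℝ))] at h1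
  rw [← integral_comp_discCount μ a (fun l => (l : ℝ) ^ 2)] at h2
  have hL : MemLp (fun z : Fin N → ℂ => pointCount a z) 2 μ := by
    refine MemLp.of_bound ?_ N (Eventually.of_forall fun z => ?_)
    · exact ((measurable_from_top (f := fun n : ℕ => (n : ℝ))).comp
        (measurable_discCount a)).aestronglyMeasurable
    · rw [pointCount_eq, Real.norm_of_nonneg (Nat.cast_nonneg _)]
      exact_mod_cast discCount_le a z
  refine ⟨?_, ?_⟩
  · rw [Finset.sum_range, ← h1]
    rfl
  · rw [numberVariance, variance_eq_sub hL]
    simp only [Pi.pow_apply, pointCount_eq]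
    change ∫ z, (discCount a z : ℝ) ^ 2 ∂μ - (∫ z, (discCount a z : ℝ) ∂μ) ^ 2 = _
    rw [h1, h2, Finset.sum_range]
    simp only [mul_sub, mul_one, Finset.sum_sub_distrib, ← sq]
    ring

end Gibbs

/-! ### Radial moments of the product weight -/

theorem areaMeasure_real_ball : areaMeasure.real (Metric.ball (0 : ℂ) 1) = 1 := by
  rw [areaMeasure, measureReal_ennreal_smul_apply, Measure.real, Complex.volume_ball]
  simp [Real.pi_pos.le, Real.pi_pos.ne']

theorem two_mul_smul_comp_sq (H : ℝ → ℝ) :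
    EqOn (fun x : ℝ => ((2 : ℝ) * x ^ ((2 : ℝ) - 1)) • H (x ^ (2 : ℝ)))
      (fun x => 2 * (x ^ (Module.finrank ℝ ℂ - 1) • H (x ^ 2))) (Ioi 0) := fun x _ => by
  simp only [Complex.finrank_real_complex, smul_eq_mul, Real.rpow_two]
  norm_num
  ring

/-- In polar coordinates `dA` has radial part `2 r dr`, which is `dy` for `y = r²`. -/
theorem integral_comp_norm_sq (H : ℝ → ℝ) :
    ∫ z : ℂ, H (‖z‖ ^ 2) ∂areaMeasure = ∫ y in Ioi (0 : ℝ), H y := by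
  rw [integral_fun_norm_addHaar areaMeasure (fun r => H (r ^ 2)), areaMeasure_real_ball,
    ← integral_comp_rpow_Ioi_of_pos (g := H) two_pos,
    setIntegral_congr_fun measurableSet_Ioi (two_mul_smul_comp_sq H), integral_const_mul]
  simp [Complex.finrank_real_complex]

theorem integrable_comp_norm_sq {H : ℝ → ℝ} (hH : IntegrableOn H (Ioi 0)) :
    Integrable (fun z : ℂ => H (‖z‖ ^ 2)) areaMeasure := by
  rw [integrable_fun_norm_addHaar areaMeasure (f := fun r => H (r ^ 2))]
  have h := (integrableOn_Ioi_comp_rpow_iff H (two_ne_zero (α := ℝ))).2 hH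
  rw [abs_of_pos two_pos] at h
  have h2 := (h.congr_fun (two_mul_smul_comp_sq H) measurableSet_Ioi).const_mul (1 / 2)
  refine h2.congr (Eventually.of_forall fun x => ?_)
  simp only
  ring

theorem radialMoment_comp_sq {κ : ℝ} (hκ : 0 < κ) (G : ℝ → ℝ) (l : ℕ) :
    radialMoment (fun r => G (κ * r ^ 2)) l =
      (κ ^ (l + 1))⁻¹ * ∫ y in Ioi (0 : ℝ), y ^ l * G y := by
  have e : ∀ y : ℝ, y ^ l * G (κ * y) = (κ ^ l)⁻¹ * (fun y => y ^ l * G y) (κ * y) := fun y => by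
    simp only [mul_pow]
    field_simp
  have h := integral_comp_norm_sq fun y => y ^ l * G (κ * y)
  simp only [← pow_mul] at h
  rw [radialMoment, h]
  simp only [e]
  rw [integral_const_mul, integral_comp_mul_left_Ioi (fun y => y ^ l * G y) 0 hκ, mul_zero, smul_eq_mul, ← mul_assoc,
    ← mul_inv, ← pow_succ]

theorem hasRadialMoments_comp_sq {κ : ℝ} (hκ : 0 < κ) {G : ℝ → ℝ}
    (hG : ∀ l : ℕ, IntegrableOn (fun y => y ^ l * G y) (Ioi 0)) :
    HasRadialMoments fun r => G (κ * r ^ 2) := by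
  have heven : ∀ l : ℕ, Integrable (fun z : ℂ => ‖z‖ ^ (2 * l) * G (κ * ‖z‖ ^ 2)) areaMeasure := by
    intro l
    have h : IntegrableOn (fun y => y ^ l * G (κ * y)) (Ioi 0) := by
      have := (integrableOn_Ioi_comp_mul_left_iff (fun y => y ^ l * G y) 0 hκ).2
        (by simpa using hG l)
      refine (this.const_mul (κ ^ l)⁻¹).congr (Eventually.of_forall fun y => ?_)
      simp only [mul_pow]
      field_simp
    simpa only [← pow_mul] using integrable_comp_norm_sq h
  intro l
  -- Odd powers are covered by `r^l ≤ 1 + r^{2l}`.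
  refine ((heven 0).norm.add (heven l).norm).mono' ?_ (Eventually.of_forall fun z => ?_)
  · have h0 := (heven 0).aestronglyMeasurable
    simp only [mul_zero, pow_zero, one_mul] at h0
    exact (by fun_prop : Continuous fun z : ℂ => ‖z‖ ^ l).aestronglyMeasurable.mul h0
  · simp only [Pi.add_apply, norm_mul, norm_pow, norm_norm, mul_zero, pow_zero, one_mul]
    rw [← one_add_mul]
    refine mul_le_mul_of_nonneg_right ?_ (norm_nonneg _)
    rw [mul_comm, pow_mul]
    nlinarith [sq_nonneg (‖z‖ ^ l - 1)]

/-- The density of a product of exponential variables, with the value at `0` set to `1`. -/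
def productWeight (n : ℕ) (y : ℝ) : ℝ := if y ≤ 0 then 1 else expProductDensity n y

/-- The convention at `y ≤ 0` makes the weight positive everywhere, as the positivity of the
partition function requires. -/
theorem productWeight_pos (n : ℕ) (y : ℝ) : 0 < productWeight n y := by
  rw [productWeight]
  split_ifs with h
  · exact one_pos
  · exact expProductDensity_pos n (not_le.1 h)

theorem productWeight_of_pos (n : ℕ) {y : ℝ} (hy : 0 < y) :
    productWeight n y = expProductDensity n y := if_neg (not_le.2 hy)

theorem integrableOn_productWeight (n l : ℕ) :
    IntegrableOn (fun y => y ^ l * productWeight n y) (Ioi 0) :=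
  (integrableOn_moment n l).congr_fun (fun y hy => by
    simp only [productWeight_of_pos n (show 0 < y from hy)]) measurableSet_Ioi

theorem integral_productWeight (n l : ℕ) :
    ∫ y in Ioi (0 : ℝ), y ^ l * productWeight n y = (l.factorial : ℝ) ^ (n + 1) := by
  rw [← integral_moment]
  exact setIntegral_congr_fun measurableSet_Ioi fun y hy => by
    simp only [productWeight_of_pos n (show 0 < y from hy)]

theorem integral_indicator_productWeight (n l : ℕ) (X : ℝ) :
    ∫ y in Ioi (0 : ℝ), y ^ l * indicator (Iio X) (productWeight n) y = lowerMoment n l X := by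
  have e : EqOn (fun y => y ^ l * indicator (Iio X) (productWeight n) y)
      (indicator (Iio X) fun y => y ^ l * expProductDensity n y) (Ioi 0) := fun y hy => by
    by_cases h : y ∈ Iio X
    · simp only [indicator_of_mem h, productWeight_of_pos n (show 0 < y from hy)]
    · simp only [indicator_of_notMem h, mul_zero]
  rw [setIntegral_congr_fun measurableSet_Ioi e, setIntegral_indicator measurableSet_Iio,
    Ioi_inter_Iio, lowerMoment]

theorem exp_neg_productPotential (σ : SymmetryClass) (n N : ℕ) (hN : 1 ≤ N) {z : ℂ} (hz : z ≠ 0) :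
    Real.exp (-((N : ℝ) * productPotential σ (n + 1) N z)) =
      productWeight n (((σ.beta : ℝ) / 2 * N) ^ (n + 1) * ‖z‖ ^ 2) := by
  have hN0 : (0 : ℝ) < N := by exact_mod_cast hN
  have hβ : (0 : ℝ) < σ.beta := by cases σ <;> simp [SymmetryClass.beta]
  have hx : 0 < ((σ.beta : ℝ) / 2 * N) ^ (n + 1) * ‖z‖ ^ 2 := by positivity
  rw [productPotential, meijerG_expProductDensity n hx, Complex.ofReal_re,
    productWeight_of_pos n hx, ← mul_assoc, ← neg_mul]
  have : -((N : ℝ) * -(1 / (N : ℝ))) = 1 := by field_simp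
  rw [this, one_mul, Real.exp_log (expProductDensity_pos n hx)]

/-- The probability that a product of `n + 1` independent Gamma variables of shape `l + 1` is less
than `x`. -/
def gammaProductCDF (n l : ℕ) (x : ℝ) : ℝ := lowerMoment n l x / (l.factorial : ℝ) ^ (n + 1)

theorem truncatedWeight_productWeight (n : ℕ) {κ a r : ℝ} (hκ : 0 < κ) (ha : 0 ≤ a) (hr : 0 ≤ r) :
    truncatedWeight (fun r => productWeight n (κ * r ^ 2)) a r =
      indicator (Iio (κ * a ^ 2)) (productWeight n) (κ * r ^ 2) := by
  have h : κ * r ^ 2 < κ * a ^ 2 ↔ r < a := by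
    rw [mul_lt_mul_iff_right₀ hκ, pow_lt_pow_iff_left₀ hr ha two_ne_zero]
  simp only [truncatedWeight, indicator, mem_Iio, h]

theorem radialMoment_div (n l : ℕ) {κ a : ℝ} (hκ : 0 < κ) (ha : 0 ≤ a) :
    radialMoment (truncatedWeight (fun r => productWeight n (κ * r ^ 2)) a) l /
      radialMoment (fun r => productWeight n (κ * r ^ 2)) l = gammaProductCDF n l (κ * a ^ 2) := by
  have e : radialMoment (truncatedWeight (fun r => productWeight n (κ * r ^ 2)) a) l =
      radialMoment (fun r => indicator (Iio (κ * a ^ 2)) (productWeight n) (κ * r ^ 2)) l := by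
    simp only [radialMoment, truncatedWeight_productWeight n hκ ha (norm_nonneg _)]
  rw [e, radialMoment_comp_sq hκ, radialMoment_comp_sq hκ, integral_indicator_productWeight,
    integral_productWeight, mul_div_mul_left _ _ (by positivity), gammaProductCDF]

theorem gammaProductCDF_nonneg (n l : ℕ) (x : ℝ) : 0 ≤ gammaProductCDF n l x :=
  div_nonneg (lowerMoment_nonneg n l x) (by positivity)

theorem one_sub_gammaProductCDF (n l : ℕ) {x : ℝ} (hx : 0 < x) :
    1 - gammaProductCDF n l x = upperMoment n l x / (l.factorial : ℝ) ^ (n + 1) := by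
  have : (l.factorial : ℝ) ^ (n + 1) ≠ 0 := by positivity
  rw [gammaProductCDF, eq_div_iff this, ← lowerMoment_add_upperMoment n l hx, sub_mul,
    div_mul_cancel₀ _ (by rwa [lowerMoment_add_upperMoment n l hx])]
  ring

/-- On `(0, x)` one has `t^l ≤ x^l`, the density has total mass one, and `(l!)^{n+1} ≥ l!`. -/
theorem gammaProductCDF_le (n l : ℕ) {x : ℝ} (hx : 0 < x) :
    gammaProductCDF n l x ≤ x ^ l / l.factorial := by
  have hI := integrableOn_moment n 0
  simp only [pow_zero, one_mul] at hI
  have h1 : lowerMoment n l x ≤ x ^ l := by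
    calc lowerMoment n l x ≤ ∫ t in Ioo 0 x, x ^ l * expProductDensity n t := by
          refine setIntegral_mono_on ((integrableOn_moment n l).mono_set fun t ht => ht.1)
            ((hI.mono_set fun t ht => ht.1).const_mul _) measurableSet_Ioo fun t ht => ?_
          exact mul_le_mul_of_nonneg_right (pow_le_pow_left₀ ht.1.le ht.2.le l)
            (expProductDensity_pos n ht.1).le
      _ = x ^ l * lowerMoment n 0 x := by
          rw [integral_const_mul, lowerMoment]
          simp only [pow_zero, one_mul]
      _ ≤ x ^ l * 1 := by
          have := lowerMoment_add_upperMoment n 0 hx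
          have h0 := upperMoment_nonneg n 0 hx
          simp only [Nat.factorial_zero, Nat.cast_one, one_pow] at this
          exact mul_le_mul_of_nonneg_left (by linarith) (by positivity)
      _ = x ^ l := mul_one _
  have hf : (1 : ℝ) ≤ l.factorial := by exact_mod_cast Nat.succ_le_of_lt l.factorial_pos
  rw [gammaProductCDF]
  refine div_le_div₀ (by positivity) h1 (by positivity) ?_
  exact le_self_pow₀ hf n.succ_ne_zero

theorem summable_gammaProductCDF (σ : SymmetryClass) (n : ℕ) {x : ℝ} (hx : 0 < x) :
    Summable fun j : ℕ => gammaProductCDF n (σ.beta / 2 * (j + 1) - 1) x := by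
  have h : Summable fun l => gammaProductCDF n l x :=
    Summable.of_nonneg_of_le (fun l => gammaProductCDF_nonneg n l x)
      (fun l => gammaProductCDF_le n l hx) (Real.summable_pow_div_factorial x)
  refine h.comp_injective (i := fun j : ℕ => σ.beta / 2 * (j + 1) - 1) fun i j hij => ?_
  cases σ <;> simp only [SymmetryClass.beta] at hij <;> omega

end PlanarEnsemble

end

/-! ### The scaling limit -/

theorem mainTheorem5 (σ : PlanarEnsemble.SymmetryClass) (m : ℕ) (hm : 1 ≤ m)
    (T : ℝ) (hT : 0 < T) :
    (∀ N : ℕ, 1 ≤ N → IsProbabilityMeasure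
      (PlanarEnsemble.gibbsMeasure σ N (PlanarEnsemble.productPotential σ m N))) ∧
    (∃ E : ℝ,
      Tendsto (fun N : ℕ => PlanarEnsemble.meanNumber σ N
          (PlanarEnsemble.productPotential σ m N) (T / (N : ℝ) ^ ((m : ℝ) / 2)))
        atTop (𝓝 E) ∧
      HasSum (fun j : ℕ =>
          1 / ((Nat.factorial (σ.beta / 2 * (j + 1) - 1) : ℂ)) ^ m
            * PlanarEnsemble.meijerLower m (σ.beta / 2 * (j + 1))
                (((σ.beta : ℝ) / 2) ^ m * T ^ 2))
        (E : ℂ)) ∧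
    (∃ V : ℝ,
      Tendsto (fun N : ℕ => PlanarEnsemble.numberVariance σ N
          (PlanarEnsemble.productPotential σ m N) (T / (N : ℝ) ^ ((m : ℝ) / 2)))
        atTop (𝓝 V) ∧
      HasSum (fun j : ℕ =>
          1 / ((Nat.factorial (σ.beta / 2 * (j + 1) - 1) : ℂ)) ^ (2 * m)
            * PlanarEnsemble.meijerLower m (σ.beta / 2 * (j + 1))
                (((σ.beta : ℝ) / 2) ^ m * T ^ 2)
            * PlanarEnsemble.meijerUpper m (σ.beta / 2 * (j + 1))
                (((σ.beta : ℝ) / 2) ^ m * T ^ 2))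
        (V : ℂ)) := by
  open PlanarEnsemble in
  obtain ⟨n, rfl⟩ : ∃ n, m = n + 1 := ⟨m - 1, by omega⟩
  have hβ : (0 : ℝ) < σ.beta := by cases σ <;> simp [SymmetryClass.beta]
  set X : ℝ := ((σ.beta : ℝ) / 2) ^ (n + 1) * T ^ 2 with hX
  have hX0 : 0 < X := by positivity
  set p : ℕ → ℝ := fun j => gammaProductCDF n (σ.beta / 2 * (j + 1) - 1) X with hp
  have hκ : ∀ N : ℕ, 1 ≤ N → 0 < ((σ.beta : ℝ) / 2 * N) ^ (n + 1) := fun N hN => by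
    have hN0 : (0 : ℝ) < N := by exact_mod_cast hN
    positivity
  have hφ : ∀ N : ℕ, 1 ≤ N → HasRadialMoments fun r =>
      productWeight n (((σ.beta : ℝ) / 2 * N) ^ (n + 1) * r ^ 2) := fun N hN =>
    hasRadialMoments_comp_sq (hκ N hN) (integrableOn_productWeight n)
  have hQ : ∀ N : ℕ, 1 ≤ N → ∀ᵐ z ∂areaMeasure,
      Real.exp (-((N : ℝ) * productPotential σ (n + 1) N z)) =
        productWeight n (((σ.beta : ℝ) / 2 * N) ^ (n + 1) * ‖z‖ ^ 2) := fun N hN => by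
    filter_upwards [Measure.ae_ne areaMeasure (0 : ℂ)] with z hz
    exact exp_neg_productPotential σ n N hN hz
  have hkey : ∀ N : ℕ, 1 ≤ N →
      meanNumber σ N (productPotential σ (n + 1) N) (T / (N : ℝ) ^ (((n + 1 : ℕ) : ℝ) / 2)) =
        ∑ i ∈ Finset.range N, p i ∧
      numberVariance σ N (productPotential σ (n + 1) N) (T / (N : ℝ) ^ (((n + 1 : ℕ) : ℝ) / 2)) =
        ∑ i ∈ Finset.range N, p i * (1 - p i) := fun N hN => by
    have hN0 : (0 : ℝ) < N := by exact_mod_cast hN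
    refine meanNumber_and_numberVariance_eq (hφ N hN) (fun r => productWeight_pos n _) (hQ N hN) _
      fun i => ?_
    rw [radialMoment_div n _ (hκ N hN) (by positivity), hp, hX]
    -- The squared radius cancels the `N^m` in `κ`, so `p` is independent of `N`.
    have hsq : ((N : ℝ) ^ (((n + 1 : ℕ) : ℝ) / 2)) ^ 2 = (N : ℝ) ^ (n + 1) := by
      rw [← Real.rpow_natCast, ← Real.rpow_mul hN0.le, ← Real.rpow_natCast]
      congr 1
      push_cast
      ring
    dsimp only
    congr 1
    rw [div_pow T, hsq, mul_pow]
    field_simp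
  -- The natural subtraction is exact because `β / 2 * (j + 1) ≥ 1`.
  have hk : ∀ j : ℕ, σ.beta / 2 * (j + 1) = (σ.beta / 2 * (j + 1) - 1) + 1 := fun j => by
    cases σ <;> simp only [SymmetryClass.beta] <;> omega
  have hlow : ∀ j : ℕ, meijerLower (n + 1) (σ.beta / 2 * (j + 1)) X =
      lowerMoment n (σ.beta / 2 * (j + 1) - 1) X := fun j => by
    conv_lhs => rw [hk j]
    exact meijerLower_eq n _ hX0
  have hup : ∀ j : ℕ, meijerUpper (n + 1) (σ.beta / 2 * (j + 1)) X =
      upperMoment n (σ.beta / 2 * (j + 1) - 1) X := fun j => by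
    conv_lhs => rw [hk j]
    exact meijerUpper_eq n _ hX0
  have hs : Summable p := summable_gammaProductCDF σ n hX0
  have hp0 : ∀ j, 0 ≤ p j := fun j => gammaProductCDF_nonneg n _ X
  have hp1 : ∀ j, 1 - p j = _ := fun j => one_sub_gammaProductCDF n _ hX0
  have hs2 : Summable fun j => p j * (1 - p j) :=
    Summable.of_nonneg_of_le
      (fun j => mul_nonneg (hp0 j) (by
        rw [hp1]; exact div_nonneg (upperMoment_nonneg n _ hX0) (by positivity)))
      (fun j => mul_le_of_le_one_right (hp0 j) (by linarith [hp0 j])) hs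
  refine ⟨fun N hN => isProbabilityMeasure_gibbsMeasure (hφ N hN) (fun r => productWeight_pos n _)
    (hQ N hN), ⟨∑' j, p j, ?_, ?_⟩, ⟨∑' j, p j * (1 - p j), ?_, ?_⟩⟩
  · refine hs.hasSum.tendsto_sum_nat.congr' ?_
    filter_upwards [eventually_ge_atTop 1] with N hN
    exact (hkey N hN).1.symm
  · refine (Complex.hasSum_ofReal.2 hs.hasSum).congr_fun fun j => ?_
    simp only [hlow, hp, gammaProductCDF]
    push_cast
    ring
  · refine hs2.hasSum.tendsto_sum_nat.congr' ?_
    filter_upwards [eventually_ge_atTop 1] with N hN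
    exact (hkey N hN).2.symm
  · refine (Complex.hasSum_ofReal.2 hs2.hasSum).congr_fun fun j => ?_
    simp only [hlow, hup, hp1]
    simp only [hp, gammaProductCDF]
    push_cast
    ring
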